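/- Let $p$ be a prime number and let $K$ be a field of characteristic $p$ with normalized discrete valuation $v_K$ and valuation ring $O_K$ ($K$ need not be complete and its residue field is arbitrary). For $n\ge 1$ let $W_n$ be the group of $p$-typical Witt vectors of length $n$, whose elements over $K$ are written $(f_{n-1},\dots,f_0)$ with $f_{n-1}$ the first Witt coordinate, and let $F:W_n(K)\to W_n(K)$ be the Frobenius $(f_{n-1},\dots,f_0)\mapsto(f_{n-1}^p,\dots,f_0^p)$. For an integer $m\ge 0$ put $$\mathrm{fil}_mW_n(K)=\{(f_{n-1},\dots,f_0)\in W_n(K)\;:\;p^jv_K(f_j)\ge -m\ \text{ for } 0\le j\le n-1\},\qquad \mathrm{fil}^F_mW_n(K)=\sum_{j\ge 0}F^j(\mathrm{fil}_mW_n(K)),$$ where the sum over $j$ means the set of all finite sums. Let $k$ be a perfect field contained in $O_K$, let $s,s'\ge 0$ and $n_1,\dots,n_s,n'_1,\dots,n'_{s'}\ge 1$ be integers, and let $h:\bigoplus_{i=1}^s W_{n_i}\to\bigoplus_{j=1}^{s'}W_{n'_j}$ be an injective homomorphism of algebraic groups over $k$, that is, one that is injective on $L$-points for every field extension $L/k$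 (for example, one with trivial scheme-theoretic kernel). Let $m\ge 0$ be an integer. Then for every $x\in\bigoplus_{i=1}^s W_{n_i}(K)$, $$x\in\bigoplus_{i=1}^s\mathrm{fil}^F_mW_{n_i}(K)\iff h(x)\in\bigoplus_{j=1}^{s'}\mathrm{fil}^F_mW_{n'_j}(K).$$ -/

import Mathlib

open scoped WithZero

universe u

namespace WittFil

/-- The map `W_n(R) → W_n(S)` induced by a map `f : R → S` on each coordinate. -/
def mapW (p : ℕ) {n : ℕ} {R S : Type u} (f : R → S) (x : TruncatedWittVector p n R) :
    TruncatedWittVector p n S :=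
  TruncatedWittVector.mk p fun i => f (x.coeff i)

/-- The Frobenius `(a_{n-1}, …, a_0) ↦ (a_{n-1}^p, …, a_0^p)` of `W_n(K)`. -/
def frob (p : ℕ) {n : ℕ} {K : Type u} [Field K] (x : TruncatedWittVector p n K) :
    TruncatedWittVector p n K :=
  TruncatedWittVector.mk p fun i => x.coeff i ^ p

/-- `fil_m W_n(K)`: the vectors `(f_{n-1}, …, f_0)` with `p ^ j * v_K(f_j) ≥ -m` for all `j`.
The first Witt coordinate is `f_{n-1}`, so `f_j` is `x.coeff (n - 1 - j)`.
The valuation is written multiplicatively: `v f = exp (-v_K(f))`, and `v 0 = 0`. -/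
def fil {K : Type u} [Field K] (v : Valuation K ℤᵐ⁰) (p n m : ℕ) :
    Set (TruncatedWittVector p n K) :=
  {x | ∀ i : Fin n, v (x.coeff i) ^ p ^ (n - 1 - (i : ℕ)) ≤ WithZero.exp (m : ℤ)}

/-- `fil^F_m W_n(K) = ∑_{j ≥ 0} F^j (fil_m W_n(K))`: the finite sums `∑_{j < N} F^j (y_j)` with
all `y_j` in `fil_m W_n(K)`. -/
def filF {K : Type u} [Field K] (v : Valuation K ℤᵐ⁰) (p : ℕ) [Fact p.Prime] (n m : ℕ) :
    Set (TruncatedWittVector p n K) :=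
  {x | ∃ (N : ℕ) (y : ℕ → TruncatedWittVector p n K),
    (∀ j, y j ∈ fil v p n m) ∧ x = ∑ j ∈ Finset.range N, (frob p)^[j] (y j)}

/-- A homomorphism `⊕_i W_{n_i} → ⊕_j W_{n'_j}` of algebraic groups over `k`, given by its functor
of points: a homomorphism of groups on `R`-points for every commutative `k`-algebra `R`, natural
in `R`. As `W_n` is represented by affine `n`-space over `k`, by Yoneda's lemma this is the same
as a morphism of group schemes over `k`. -/
structure WittSumHom (p : ℕ) [Fact p.Prime] (k : Type u) [Field k] {s s' : ℕ}
    (n : Fin s → ℕ) (n' : Fin s' → ℕ) where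
  /-- the map on `R`-points -/
  app : ∀ (R : Type u) [CommRing R] [Algebra k R],
    (∀ i, TruncatedWittVector p (n i) R) →+ (∀ j, TruncatedWittVector p (n' j) R)
  naturality : ∀ (R S : Type u) [CommRing R] [CommRing S] [Algebra k R] [Algebra k S]
    (f : R →ₐ[k] S) (x : ∀ i, TruncatedWittVector p (n i) R),
    app S (fun i => mapW p f (x i)) = fun j => mapW p f (app R x j)

/-- Injectivity of a homomorphism of algebraic groups over `k`: injectivity on `L`-points for every
field extension `L` of `k`. In particular it holds when the scheme-theoretic kernel is trivial. -/
def WittSumHom.Injective {p : ℕ} [Fact p.Prime] {k : Type u} [Field k] {s s' : ℕ}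
    {n : Fin s → ℕ} {n' : Fin s' → ℕ} (h : WittSumHom p k n n') : Prop :=
  ∀ (L : Type u) [Field L] [Algebra k L], Function.Injective (h.app L)

end WittFil

/-! The set `filF` is a `W(k)`-submodule that is saturated under Frobenius (`F x` lies in it iff `x`
does), and membership is neither gained nor lost under the embeddings `V^a : W_n → W_{n+a}`
(`mem_filF_of_frob_mem`, `map_mul_mem_filF`, `truncate_mem_filF_iff`). Embed all lengths in one
`W_{N+1}`. After a power of Frobenius, `h` becomes a matrix of polynomials `∑ c_l F^l` over `W(k)`
acting on the vectors `X i = F^{a_i} V^{a_i} x_i` (`WittSumHom.exists_coeff`). This gives the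
forward implication at once.

For the converse let `P ⊆ W(K)` be the preimage of `filF` and suppose that the combinations `∑ c_l
F^l (X i)` lie in `P` but some `X i` does not. Enlarge `P` to a maximal saturated submodule `Q`
missing some `X i`. In `W(K)/Q` every nonzero saturated submodule contains all the `X i`; applied to
the `p`-torsion, this moves the problem into a `k`-vector space with an injective semilinear `F`.
There a nonzero `q = X i₀` must satisfy a relation `F^d q = ∑ b_l F^l q` with `b_0 ≠ 0`. A nonzero
root of the corresponding additive polynomial gives an `F`-equivariant map to the algebraic closure,
hence a nonzero point `z` at which all relations of the `X i` modulo `P` hold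
(`exists_point_of_notMem_saturated`). Vectors concentrated in the last coordinate, built from `z`,
are then a nonzero element of the kernel of `h`, against injectivity
(`WittSumHom.eq_zero_of_injective`). -/

/-! ### Linear algebra: independence of sequences and prescribed linear maps. -/

theorem linearIndependent_fin_of_notMem_span {k T : Type*} [Field k] [AddCommGroup T] [Module k T]
    (v : ℕ → T) (n : ℕ) (h : ∀ l < n, v l ∉ Submodule.span k (v '' Set.Iio l)) :
    LinearIndependent k (fun l : Fin n => v l) := by
  induction n with
  | zero => exact linearIndependent_empty_type
  | succ n ih =>
    rw [linearIndependent_finSucc']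
    refine ⟨ih fun l hl => h l (hl.trans n.lt_succ_self), ?_⟩
    have : Set.range (Fin.init fun l : Fin (n + 1) => v l) = v '' Set.Iio n := by
      ext x
      constructor
      · rintro ⟨i, rfl⟩
        exact ⟨i, i.2, rfl⟩
      · rintro ⟨i, hi, rfl⟩
        exact ⟨⟨i, hi⟩, rfl⟩
    rw [this]
    exact h n n.lt_succ_self

theorem linearIndependent_nat_of_notMem_span {k T : Type*} [Field k] [AddCommGroup T] [Module k T]
    (v : ℕ → T) (h : ∀ l, v l ∉ Submodule.span k (v '' Set.Iio l)) : LinearIndependent k v := by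
  rw [linearIndependent_iff_finset_linearIndependent]
  intro s
  have := linearIndependent_fin_of_notMem_span v (s.sup id + 1) fun l _ => h l
  exact this.comp (fun x : s => ⟨x, Nat.lt_succ_of_le (Finset.le_sup (f := id) x.2)⟩)
    fun x y hxy => Subtype.ext (by simpa using hxy)

theorem LinearIndependent.exists_linearMap_apply_eq {ι k T U : Type*} [Field k] [AddCommGroup T]
    [Module k T] [AddCommGroup U] [Module k U] {v : ι → T} (hv : LinearIndependent k v)
    (u : ι → U) : ∃ f : T →ₗ[k] U, ∀ i, f (v i) = u i := by
  obtain ⟨f, hf⟩ := LinearMap.exists_extend ((Finsupp.linearCombination k u).comp hv.repr)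
  refine ⟨f, fun i => ?_⟩
  have := LinearMap.congr_fun hf ⟨v i, Submodule.subset_span ⟨i, rfl⟩⟩
  rw [LinearMap.comp_apply] at this
  simpa [hv.repr_eq_single i ⟨v i, Submodule.subset_span ⟨i, rfl⟩⟩ rfl] using this

/-! ### Vector spaces with a `p`-semilinear operator. -/

section Frobenius

variable {k T : Type*} [Field k] {p : ℕ} [AddCommGroup T] [Module k T]

theorem AddMonoid.End.pow_smul_of_semilinear {F : AddMonoid.End T}
    (hF : ∀ (a : k) x, F (a • x) = a ^ p • F x) (l : ℕ) (a : k) (x : T) :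
    (F ^ l) (a • x) = a ^ p ^ l • (F ^ l) x := by
  induction l with
  | zero => simp
  | succ l ih => rw [pow_succ', AddMonoid.End.coe_mul, Function.comp_apply, ih, hF, ← pow_mul, pow_succ]; rfl

/-- The vectors that some power of a semilinear operator `F` moves into an `F`-stable subspace. -/
def Submodule.frobeniusSaturation {F : AddMonoid.End T}
    (hF : ∀ (a : k) x, F (a • x) = a ^ p • F x) (D : Submodule k T) (hD : ∀ x ∈ D, F x ∈ D) :
    Submodule k T where
  carrier := {x | ∃ e : ℕ, (F ^ e) x ∈ D}
  zero_mem' := ⟨0, by simp⟩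
  add_mem' := by
    have key : ∀ (e : ℕ) x, x ∈ D → (F ^ e) x ∈ D := by
      intro e
      induction e with
      | zero => intro x hx; simpa using hx
      | succ e ih => intro x hx; rw [pow_succ]; exact ih _ (hD _ hx)
    rintro x y ⟨e, he⟩ ⟨e', he'⟩
    refine ⟨e + e', ?_⟩
    rw [map_add]
    refine add_mem ?_ ?_
    · rw [add_comm, pow_add]; exact key _ _ he
    · rw [pow_add]; exact key _ _ he'
  smul_mem' := by
    rintro c x ⟨e, he⟩
    exact ⟨e, by rw [AddMonoid.End.pow_smul_of_semilinear hF]; exact D.smul_mem _ he⟩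

theorem Submodule.apply_mem_frobeniusSaturation {F : AddMonoid.End T}
    (hF : ∀ (a : k) x, F (a • x) = a ^ p • F x) (D : Submodule k T) (hD : ∀ x ∈ D, F x ∈ D)
    (x : T) : F x ∈ D.frobeniusSaturation hF hD ↔ x ∈ D.frobeniusSaturation hF hD := by
  constructor
  · rintro ⟨e, he⟩
    exact ⟨e + 1, by rw [pow_succ]; exact he⟩
  · rintro ⟨e, he⟩
    refine ⟨e, ?_⟩
    have : (F ^ (e + 1)) x ∈ D := by rw [pow_succ']; exact hD _ he
    rwa [pow_succ] at this

theorem Submodule.pow_apply_mem_of_le {F : AddMonoid.End T} (D : Submodule k T)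
    (hD : ∀ x ∈ D, F x ∈ D) {x : T} {e E : ℕ} (he : (F ^ e) x ∈ D) (h : e ≤ E) : (F ^ E) x ∈ D := by
  induction E, h using Nat.le_induction with
  | base => exact he
  | succ E _ ih => rw [pow_succ']; exact hD _ ih

/-- If the iterates of `q` were independent, the functional `F^l q ↦ (-1)^l` would kill every
iterate of `q + F q` but no `F^e q`. The saturation of the span of those iterates would then be
nonzero without containing `q`. -/
theorem exists_mem_span_iterate_of_saturation {F : AddMonoid.End T}
    (hF : ∀ (a : k) x, F (a • x) = a ^ p • F x) (q : T)
    (hsat : ∀ P : Submodule k T, (∀ x, F x ∈ P ↔ x ∈ P) → P ≠ ⊥ → q ∈ P) :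
    ∃ d, (F ^ d) q ∈ Submodule.span k ((fun l : ℕ => (F ^ l) q) '' Set.Iio d) := by
  by_contra! hcon
  have hli := linearIndependent_nat_of_notMem_span (k := k) _ hcon
  obtain ⟨f, hf⟩ := hli.exists_linearMap_apply_eq (fun l => (-1 : k) ^ l)
  have hr : q + F q ≠ 0 := by
    intro h0
    refine hcon 1 ?_
    have : (F ^ 1) q = - (F ^ 0) q := by
      rw [pow_one, pow_zero]; exact (neg_eq_of_add_eq_zero_right h0).symm
    rw [this]
    exact neg_mem (Submodule.subset_span ⟨0, by simp, rfl⟩)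
  set D := Submodule.span k (Set.range fun l : ℕ => (F ^ l) (q + F q)) with hDdef
  have hD : ∀ x ∈ D, F x ∈ D := by
    intro x hx
    induction hx using Submodule.span_induction with
    | mem x h =>
      obtain ⟨l, rfl⟩ := h
      exact Submodule.subset_span ⟨l + 1, by simp only [pow_succ']; rfl⟩
    | zero => simp
    | add x y _ _ hx hy => rw [map_add]; exact add_mem hx hy
    | smul a x _ hx => rw [hF]; exact D.smul_mem _ hx
  have hfD : ∀ x ∈ D, f x = 0 := by
    intro x hx
    induction hx using Submodule.span_induction with
    | mem x h =>
      obtain ⟨l, rfl⟩ := h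
      have h1 : (F ^ l) (q + F q) = (F ^ l) q + (F ^ (l + 1)) q := by
        rw [map_add, pow_succ]; rfl
      simp only [h1, map_add, hf]
      ring
    | zero => simp
    | add x y _ _ hx hy => rw [map_add, hx, hy, add_zero]
    | smul a x _ hx => rw [map_smul, hx, smul_zero]
  obtain ⟨e, he⟩ : q ∈ D.frobeniusSaturation hF hD := by
    refine hsat _ (D.apply_mem_frobeniusSaturation hF hD) ?_
    rw [Submodule.ne_bot_iff]
    exact ⟨q + F q, ⟨0, Submodule.subset_span ⟨0, by simp⟩⟩, hr⟩
  have := hfD _ he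
  rw [hf] at this
  exact pow_ne_zero e (neg_ne_zero.2 one_ne_zero) this

open Polynomial in
-- After division by `z` the equation has positive degree `p^d - 1` and constant term `-b 0 ≠ 0`, so
-- it has a root and the root is not zero.
theorem exists_ne_zero_pow_eq_sum [Fact p.Prime] {L : Type*} [Field L] [IsAlgClosed L] {d : ℕ}
    (b : ℕ → L) (hd : 0 < d) (hb : b 0 ≠ 0) :
    ∃ z : L, z ≠ 0 ∧ z ^ p ^ d = ∑ l ∈ Finset.range d, b l * z ^ p ^ l := by
  have hp := (Fact.out : p.Prime)
  have hpow : ∀ l, 0 < p ^ l := fun l => pow_pos hp.pos l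
  set g : L[X] := ∑ l ∈ Finset.range d, C (b l) * X ^ (p ^ l - 1) with hg
  have hdeg : g.degree < (p ^ d - 1 : ℕ) := by
    refine (Polynomial.degree_sum_le _ _).trans_lt ?_
    rw [Finset.sup_lt_iff (WithBot.bot_lt_coe _)]
    intro l hl
    refine (degree_C_mul_X_pow_le _ _).trans_lt ?_
    have : p ^ l < p ^ d := Nat.pow_lt_pow_right hp.one_lt (Finset.mem_range.1 hl)
    have := hpow l
    exact_mod_cast (by omega : p ^ l - 1 < p ^ d - 1)
  have h1 : 1 < p ^ d := Nat.one_lt_pow hd.ne' hp.one_lt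
  have hdeg' : (X ^ (p ^ d - 1) - g).degree ≠ 0 := by
    rw [degree_sub_eq_left_of_degree_lt (by rwa [degree_X_pow]), degree_X_pow]
    exact_mod_cast (by omega : p ^ d - 1 ≠ 0)
  obtain ⟨z, hz⟩ := IsAlgClosed.exists_root _ hdeg'
  have hz' : z ^ (p ^ d - 1) = ∑ l ∈ Finset.range d, b l * z ^ (p ^ l - 1) := by
    have := hz
    simpa [IsRoot, hg, eval_finsetSum, sub_eq_zero] using this
  refine ⟨z, ?_, ?_⟩
  · rintro rfl
    rw [zero_pow (by omega), Finset.sum_eq_single 0] at hz'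
    · simp at hz'; exact hb hz'.symm
    · intro l _ hl
      have := Nat.one_lt_pow hl hp.one_lt
      rw [zero_pow (by omega), mul_zero]
    · intro h; simp at h; omega
  · have h2 : ∀ l, z ^ p ^ l = z ^ (p ^ l - 1) * z := fun l => by
      rw [← pow_succ, Nat.sub_add_cancel (hpow l)]
    rw [h2, hz', Finset.sum_mul]
    exact Finset.sum_congr rfl fun l _ => by rw [h2 l, mul_assoc]

/-- A nonzero finite family in a vector space with an injective `p`-semilinear operator, such that
every nonzero saturated subspace contains it, specializes to a nonzero point over the algebraic
closure satisfying all the relations of the family. -/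
theorem exists_point_of_forall_saturated {ι : Type*} [Fintype ι] [Fact p.Prime] [CharP k p] [PerfectRing k p]
    {F : AddMonoid.End T} (hF : ∀ (a : k) x, F (a • x) = a ^ p • F x)
    (hinj : Function.Injective F) (X : ι → T) (i₀ : ι) (hX : X i₀ ≠ 0)
    (hsat : ∀ P : Submodule k T, (∀ x, F x ∈ P ↔ x ∈ P) → P ≠ ⊥ → ∀ i, X i ∈ P) :
    ∃ z : ι → AlgebraicClosure k, z i₀ ≠ 0 ∧ ∀ (M : ℕ) (a : ι → ℕ → k),
      ∑ i, ∑ l ∈ Finset.range M, a i l • (F ^ l) (X i) = 0 →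
        ∑ i, ∑ l ∈ Finset.range M, algebraMap k (AlgebraicClosure k) (a i l) * z i ^ p ^ l = 0 := by
  classical
  have hp := (Fact.out : p.Prime)
  have : CharP (AlgebraicClosure k) p := charP_of_injective_algebraMap' k p
  set q := X i₀ with hq
  have hex := exists_mem_span_iterate_of_saturation hF q fun P h1 h2 => hsat P h1 h2 i₀
  set d := Nat.find hex with hd
  have hmem := Nat.find_spec hex
  have hmin : ∀ l < d, (F ^ l) q ∉ Submodule.span k ((fun l : ℕ => (F ^ l) q) '' Set.Iio l) :=
    fun l hl => Nat.find_min hex hl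
  rw [← hd] at hmem
  clear_value d
  have hd0 : 0 < d := by
    rcases Nat.eq_zero_or_pos d with h | h
    · rw [h] at hmem
      simp at hmem
      exact absurd hmem hX
    · exact h
  have hli := linearIndependent_fin_of_notMem_span (k := k) (fun l : ℕ => (F ^ l) q) d hmin
  have hmem' := hmem
  rw [← Finset.coe_range, Submodule.mem_span_image_finset_iff_exists_fun'] at hmem'
  obtain ⟨b, hb⟩ := hmem'
  -- Otherwise the relation is `F` applied to the relation with `p`-th roots as coefficients (`k` is
  -- perfect), and injectivity of `F` gives a shorter one, against the minimality of `d`.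
  have hb0 : b 0 ≠ 0 := by
    intro h0
    obtain ⟨d', rfl⟩ : ∃ d', d = d' + 1 := ⟨d - 1, by omega⟩
    refine hmin d' (Nat.lt_succ_self _) ?_
    rw [Finset.sum_range_succ', h0, zero_smul, add_zero] at hb
    have h1 : F (∑ l ∈ Finset.range d', (frobeniusEquiv k p).symm (b (l + 1)) • (F ^ l) q)
        = F ((F ^ d') q) := by
      rw [map_sum]
      have h2 : F ((F ^ d') q) = (F ^ (d' + 1)) q := by rw [pow_succ']; rfl
      rw [h2, ← hb]
      refine Finset.sum_congr rfl fun l _ => ?_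
      rw [hF, frobeniusEquiv_symm_pow_p, pow_succ']
      rfl
    rw [← hinj h1]
    exact Submodule.sum_mem _ fun l hl => Submodule.smul_mem _ _
      (Submodule.subset_span ⟨l, Finset.mem_range.1 hl, rfl⟩)
  obtain ⟨w, hw0, hw⟩ := exists_ne_zero_pow_eq_sum (p := p)
    (fun l => algebraMap k (AlgebraicClosure k) (b l)) hd0 (by simpa using hb0)
  -- The map `ψ` turns `F` into the `p`-th power on the span `D` of the iterates. The only critical
  -- case is `F^d q`, where the equation of `w` matches the relation of `q`.
  obtain ⟨ψ, hψ⟩ := hli.exists_linearMap_apply_eq (fun l => w ^ p ^ (l : ℕ))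
  have hψd : ∀ l ≤ d, ψ ((F ^ l) q) = w ^ p ^ l := by
    intro l hl
    rcases hl.lt_or_eq with h | rfl
    · exact hψ ⟨l, h⟩
    · rw [← hb, hw, map_sum]
      refine Finset.sum_congr rfl fun i hi => ?_
      rw [map_smul, Algebra.smul_def]
      congr 1
      exact hψ ⟨i, Finset.mem_range.1 hi⟩
  set D := Submodule.span k ((fun l : ℕ => (F ^ l) q) '' Set.Iio d) with hDdef
  have hD2 : ∀ x ∈ D, F x ∈ D ∧ ψ (F x) = ψ x ^ p := by
    intro x hx
    induction hx using Submodule.span_induction with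
    | mem x h =>
      obtain ⟨l, hl, rfl⟩ := h
      have h1 : F ((F ^ l) q) = (F ^ (l + 1)) q := by rw [pow_succ']; rfl
      have hl' : l + 1 ≤ d := hl
      simp only [h1]
      rw [hψd _ hl', hψd _ (Nat.le_of_succ_le hl'), ← pow_mul, ← pow_succ]
      refine ⟨?_, rfl⟩
      rcases hl'.lt_or_eq with h | h
      · exact Submodule.subset_span ⟨l + 1, h, rfl⟩
      · rw [h]; exact hmem
    | zero => simp [hp.ne_zero]
    | add x y _ _ hx hy =>
      rw [map_add, map_add, map_add, hx.2, hy.2, add_pow_char]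
      exact ⟨add_mem hx.1 hy.1, rfl⟩
    | smul a x _ hx =>
      rw [hF, map_smul, map_smul, hx.2, smul_pow]
      exact ⟨D.smul_mem _ hx.1, rfl⟩
  have hD : ∀ x ∈ D, F x ∈ D := fun x hx => (hD2 x hx).1
  have hψpow : ∀ (l : ℕ) (x), x ∈ D → ψ ((F ^ l) x) = ψ x ^ p ^ l := by
    intro l
    induction l with
    | zero => intro x _; simp
    | succ l ih =>
      intro x hx
      have h1 : (F ^ (l + 1)) x = (F ^ l) (F x) := by rw [pow_succ]; rfl
      rw [h1, ih _ (hD x hx), (hD2 x hx).2, ← pow_mul, ← pow_succ']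
  have hqD : q ∈ D := Submodule.subset_span ⟨0, hd0, by simp⟩
  have hXsat : ∀ i, X i ∈ D.frobeniusSaturation hF hD := by
    refine hsat _ (D.apply_mem_frobeniusSaturation hF hD) ?_
    rw [Submodule.ne_bot_iff]
    exact ⟨q, ⟨0, by simpa using hqD⟩, hX⟩
  -- The `X i` need not lie in `D`, but a common power `F^E` brings them there; `z i` is the
  -- `p^E`-th root of the value of `ψ`.
  choose e he using hXsat
  set E := Finset.univ.sup e with hE
  have hED : ∀ i, (F ^ E) (X i) ∈ D := fun i =>
    D.pow_apply_mem_of_le hD (he i) (Finset.le_sup (Finset.mem_univ i))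
  have hpE : 0 < p ^ E := pow_pos hp.pos E
  choose z hz using fun i => IsAlgClosed.exists_pow_nat_eq (ψ ((F ^ E) (X i))) hpE
  refine ⟨z, ?_, ?_⟩
  · intro h0
    have h1 := hz i₀
    rw [h0, zero_pow hpE.ne', hψpow _ _ hqD] at h1
    have h2 := hψd 0 hd0.le
    simp only [pow_zero, pow_one] at h2
    have h3 : ψ q = w := h2
    rw [h3] at h1
    exact pow_ne_zero _ hw0 h1.symm
  · intro M a ha
    -- Applying `F^E` and then `ψ` to the relation yields the `p^E`-th power of the desired sum.
    have h1 := congrArg ψ (congrArg (F ^ E) ha)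
    simp only [map_sum, map_zero] at h1
    refine eq_zero_of_pow_eq_zero (n := p ^ E) ?_
    rw [sum_pow_char_pow, ← h1]
    refine Finset.sum_congr rfl fun i _ => ?_
    rw [sum_pow_char_pow]
    refine Finset.sum_congr rfl fun l _ => ?_
    have h2 : (F ^ E) ((F ^ l) (X i)) = (F ^ l) ((F ^ E) (X i)) := by
      have := pow_add F E l
      rw [add_comm, pow_add] at this
      exact (DFunLike.congr_fun this (X i)).symm
    rw [AddMonoid.End.pow_smul_of_semilinear hF, h2, map_smul, hψpow _ _ (hED i), ← hz i,
      Algebra.smul_def, mul_pow, map_pow, ← pow_mul, ← pow_mul, mul_comm (p ^ E)]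

end Frobenius

/-! ### Modules over `W(k)` with a semilinear Frobenius. -/

section WittModule

variable {p : ℕ} [Fact p.Prime] {k : Type*} [Field k] [CharP k p] [PerfectRing k p]
  {ι : Type*} [Fintype ι] {M : Type*} [AddCommGroup M] [Module (WittVector p k) M]

/-- As `k` is perfect, `p W(k)` is the ideal of vectors with zero first coordinate, so `c` and
`[c_0]` differ by a multiple of `p`. -/
theorem WittVector.smul_eq_teichmuller_smul (hpM : ∀ x : M, (p : WittVector p k) • x = 0)
    (c : WittVector p k) (x : M) : c • x = WittVector.teichmuller p (c.coeff 0) • x := by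
  have h : (c - WittVector.teichmuller p (c.coeff 0)) ∈ Ideal.span {(p : WittVector p k)} := by
    rw [WittVector.mem_span_p_iff_coeff_zero_eq_zero]
    change WittVector.constantCoeff (c - _) = 0
    rw [map_sub, sub_eq_zero]
    exact (WittVector.teichmuller_coeff_zero p _).symm
  obtain ⟨b, hb⟩ := Ideal.mem_span_singleton'.1 h
  rw [← sub_eq_zero, ← sub_smul, ← hb, mul_smul, hpM, smul_zero]

/-- A module over `W(k)` killed by `p` is a `k`-vector space. -/
@[reducible]
noncomputable def WittVector.moduleOfSmulEqZero (hpM : ∀ x : M, (p : WittVector p k) • x = 0) : Module k M where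
  smul a x := WittVector.teichmuller p a • x
  one_smul x := by
    change WittVector.teichmuller p (1 : k) • x = x
    rw [map_one, one_smul]
  mul_smul a b x := by
    change WittVector.teichmuller p (a * b) • x = _
    rw [map_mul, mul_smul]
    rfl
  smul_zero a := smul_zero (WittVector.teichmuller p a)
  smul_add a := smul_add (WittVector.teichmuller p a)
  zero_smul x := by
    change WittVector.teichmuller p (0 : k) • x = 0
    rw [WittVector.teichmuller_zero, zero_smul]
  add_smul a b x := by
    change WittVector.teichmuller p (a + b) • x
      = WittVector.teichmuller p a • x + WittVector.teichmuller p b • x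
    rw [← add_smul, WittVector.smul_eq_teichmuller_smul hpM (_ + _)]
    congr 2
    change _ = WittVector.constantCoeff (WittVector.teichmuller p a + WittVector.teichmuller p b)
    rw [map_add]
    exact congrArg₂ (· + ·) (WittVector.teichmuller_coeff_zero p a).symm
      (WittVector.teichmuller_coeff_zero p b).symm

theorem exists_point_of_p_smul_eq_zero (hpM : ∀ x : M, (p : WittVector p k) • x = 0)
    {F : AddMonoid.End M}
    (hF : ∀ (c : WittVector p k) x, F (c • x) = WittVector.frobenius c • F x)
    (hinj : Function.Injective F) (X : ι → M) (i₀ : ι) (hX : X i₀ ≠ 0)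
    (hsat : ∀ P : Submodule (WittVector p k) M, (∀ x, F x ∈ P ↔ x ∈ P) → P ≠ ⊥ → ∀ i, X i ∈ P) :
    ∃ z : ι → AlgebraicClosure k, z i₀ ≠ 0 ∧ ∀ (m : ℕ) (c : ι → ℕ → WittVector p k),
      ∑ i, ∑ l ∈ Finset.range m, c i l • (F ^ l) (X i) = 0 →
        ∑ i, ∑ l ∈ Finset.range m,
          algebraMap k (AlgebraicClosure k) ((c i l).coeff 0) * z i ^ p ^ l = 0 := by
  let := WittVector.moduleOfSmulEqZero hpM
  have hsm : ∀ (c : WittVector p k) (x : M), c • x = c.coeff 0 • x :=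
    WittVector.smul_eq_teichmuller_smul hpM
  obtain ⟨z, hz, h⟩ := exists_point_of_forall_saturated (k := k) (p := p) (F := F)
    (by
      intro a x
      change F (WittVector.teichmuller p a • x) = _
      rw [hF, hsm, WittVector.coeff_frobenius_charP, WittVector.teichmuller_coeff_zero])
    hinj X i₀ hX
    (by
      intro P hP hne
      refine hsat { P with smul_mem' := fun c x hx => by rw [hsm]; exact P.smul_mem _ hx } hP ?_
      rw [Submodule.ne_bot_iff] at hne ⊢
      exact hne)
  refine ⟨z, hz, fun m c hc => h m _ ?_⟩
  simpa only [hsm] using hc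

/-- The `p`-torsion is saturated because `F` is injective and commutes with `p`, and nonzero because
`p` is nilpotent on `M`. Hence it contains all `X i`, and its saturated submodules remain saturated
in `M`. -/
theorem exists_point_of_p_pow_smul_eq_zero (N : ℕ)
    (hpM : ∀ x : M, (p : WittVector p k) ^ N • x = 0) {F : AddMonoid.End M}
    (hF : ∀ (c : WittVector p k) x, F (c • x) = WittVector.frobenius c • F x)
    (hinj : Function.Injective F) (X : ι → M) (i₀ : ι) (hX : X i₀ ≠ 0)
    (hsat : ∀ P : Submodule (WittVector p k) M, (∀ x, F x ∈ P ↔ x ∈ P) → P ≠ ⊥ → ∀ i, X i ∈ P) :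
    ∃ z : ι → AlgebraicClosure k, z i₀ ≠ 0 ∧ ∀ (m : ℕ) (c : ι → ℕ → WittVector p k),
      ∑ i, ∑ l ∈ Finset.range m, c i l • (F ^ l) (X i) = 0 →
        ∑ i, ∑ l ∈ Finset.range m,
          algebraMap k (AlgebraicClosure k) ((c i l).coeff 0) * z i ^ p ^ l = 0 := by
  have hFp : ∀ x, F ((p : WittVector p k) • x) = (p : WittVector p k) • F x := fun x => by
    rw [hF, map_natCast]
  set T := Submodule.torsionBy (WittVector p k) M (p : WittVector p k) with hT
  have hFT : ∀ x, F x ∈ T ↔ x ∈ T := fun x => by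
    rw [Submodule.mem_torsionBy_iff, Submodule.mem_torsionBy_iff, ← hFp, map_eq_zero_iff F hinj]
  have hT0 : T ≠ ⊥ := by
    intro h0
    have hpi : ∀ (n : ℕ) (x : M), (p : WittVector p k) ^ n • x = 0 → x = 0 := by
      intro n
      induction n with
      | zero => intro x hx; simpa using hx
      | succ n ih =>
        intro x hx
        refine ih x ?_
        rw [pow_succ', mul_smul] at hx
        have : (p : WittVector p k) ^ n • x ∈ T := hx
        rw [h0] at this
        exact this
    exact hX (hpi N _ (hpM _))
  have hXT := hsat T hFT hT0
  let G : AddMonoid.End T := (F.comp T.subtype.toAddMonoidHom).codRestrict T fun x => (hFT x).2 x.2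
  have hG : ∀ x : T, ((G x : T) : M) = F x := fun _ => rfl
  have hGpow : ∀ (l : ℕ) (x : T), (((G ^ l) x : T) : M) = (F ^ l) x := by
    intro l
    induction l with
    | zero => intro x; rfl
    | succ l ih => intro x; rw [pow_succ, pow_succ]; exact ih (G x)
  obtain ⟨z, hz, h⟩ := exists_point_of_p_smul_eq_zero (M := T) (F := G)
    (fun x => Subtype.ext ((Submodule.mem_torsionBy_iff _ _).1 x.2)) (fun c x => Subtype.ext (hF c x))
    (fun x y hxy => Subtype.ext (hinj (congrArg Subtype.val hxy))) (fun i => ⟨X i, hXT i⟩) i₀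
    (fun h => hX (congrArg Subtype.val h))
    (by
      intro P hP hne i
      have hm : ∀ x : T, (x : M) ∈ P.map T.subtype ↔ x ∈ P := fun x => by simp
      have := hsat (P.map T.subtype) (fun x => ?_) ?_ i
      · exact (hm ⟨X i, hXT i⟩).1 this
      · constructor
        · intro hx
          have hxT : x ∈ T := (hFT x).1 (Submodule.map_subtype_le _ _ hx)
          exact (hm ⟨x, hxT⟩).2 ((hP ⟨x, hxT⟩).1 ((hm (G ⟨x, hxT⟩)).1 hx))
        · intro hx
          have hxT : x ∈ T := Submodule.map_subtype_le _ _ hx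
          exact (hm (G ⟨x, hxT⟩)).2 ((hP ⟨x, hxT⟩).2 ((hm ⟨x, hxT⟩).1 hx))
      · rw [Submodule.ne_bot_iff] at hne ⊢
        obtain ⟨x, hx, hx0⟩ := hne
        exact ⟨x, (hm x).2 hx, fun h => hx0 (Subtype.ext h)⟩)
  refine ⟨z, hz, fun m c hc => h m c (Subtype.ext ?_)⟩
  simp only [Submodule.coe_sum, Submodule.coe_smul, hGpow]
  exact hc

/-- If not all members of a finite family lie in a saturated submodule `P` containing `p ^ N M`,
then there is a nonzero point over the algebraic closure which satisfies every relation that holds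
for the family modulo `P`. -/
theorem exists_point_of_notMem_saturated (N : ℕ) {F : AddMonoid.End M}
    (hF : ∀ (c : WittVector p k) x, F (c • x) = WittVector.frobenius c • F x)
    (P : Submodule (WittVector p k) M) (hP : ∀ x, F x ∈ P ↔ x ∈ P)
    (hpP : ∀ x : M, (p : WittVector p k) ^ N • x ∈ P) (X : ι → M) (hX : ¬ ∀ i, X i ∈ P) :
    ∃ z : ι → AlgebraicClosure k, z ≠ 0 ∧ ∀ (m : ℕ) (c : ι → ℕ → WittVector p k),
      ∑ i, ∑ l ∈ Finset.range m, c i l • (F ^ l) (X i) ∈ P →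
        ∑ i, ∑ l ∈ Finset.range m,
          algebraMap k (AlgebraicClosure k) ((c i l).coeff 0) * z i ^ p ^ l = 0 := by
  -- Finiteness of `ι` keeps the union of a chain in this family. Maximality of `Q` says that every
  -- nonzero saturated submodule of `M ⧸ Q` contains all classes of the `X i`.
  obtain ⟨Q, hPQ, hQ⟩ := zorn_le_nonempty₀
    {Q : Submodule (WittVector p k) M | (∀ x, F x ∈ Q ↔ x ∈ Q) ∧ ¬ ∀ i, X i ∈ Q}
    (by
      intro C hC hchain y hy
      have hne : C.Nonempty := ⟨y, hy⟩
      have hmem : ∀ x, x ∈ sSup C ↔ ∃ Q ∈ C, x ∈ Q := fun x =>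
        Submodule.mem_sSup_of_directed hne hchain.directedOn
      refine ⟨sSup C, ⟨fun x => ?_, fun h => ?_⟩, fun Q hQ => le_sSup hQ⟩
      · rw [hmem, hmem]
        exact exists_congr fun Q => and_congr_right fun hQ => (hC hQ).1 x
      · obtain ⟨Q, hQC, hQ⟩ : ∃ Q ∈ C, ∀ i ∈ (Finset.univ : Finset ι), X i ∈ Q := by
          have h' := fun i => (hmem (X i)).1 (h i)
          choose Q hQC hQ using h'
          classical
          have : ∀ s : Finset ι, ∃ R ∈ C, ∀ i ∈ s, X i ∈ R := by
            intro s
            induction s using Finset.induction_on with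
            | empty => exact ⟨y, hy, by simp⟩
            | insert a s _ ih =>
              obtain ⟨R, hR, hRs⟩ := ih
              obtain ⟨R', hR', h1, h2⟩ := hchain.directedOn _ (hQC a) _ hR
              refine ⟨R', hR', fun i hi => ?_⟩
              rcases Finset.mem_insert.1 hi with rfl | hi
              · exact h1 (hQ i)
              · exact h2 (hRs i hi)
          exact this _
        exact (hC hQC).2 fun i => hQ i (Finset.mem_univ i))
    P ⟨hP, hX⟩
  obtain ⟨⟨hFQ, hXQ⟩, hmax⟩ := hQ
  push Not at hXQ
  obtain ⟨i₀, hi₀⟩ := hXQ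
  let F' : M →ₛₗ[(WittVector.frobenius : WittVector p k →+* WittVector p k)] M :=
    { F with map_smul' := hF }
  let G : AddMonoid.End (M ⧸ Q) := (Q.mapQ Q F' fun x hx => (hFQ x).2 hx).toAddMonoidHom
  have hG : ∀ x : M, G (Q.mkQ x) = Q.mkQ (F x) := fun _ => rfl
  have hGpow : ∀ (l : ℕ) (x : M), (G ^ l) (Q.mkQ x) = Q.mkQ ((F ^ l) x) := by
    intro l
    induction l with
    | zero => intro x; rfl
    | succ l ih => intro x; rw [pow_succ, pow_succ]; exact ih (F x)
  obtain ⟨z, hz, h⟩ := exists_point_of_p_pow_smul_eq_zero (M := M ⧸ Q) N (F := G)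
    (fun x => by
      obtain ⟨x, rfl⟩ := Q.mkQ_surjective x
      rw [← map_smul, Submodule.mkQ_apply, Submodule.Quotient.mk_eq_zero]
      exact hPQ (hpP x))
    (fun c x => by
      obtain ⟨x, rfl⟩ := Q.mkQ_surjective x
      rw [← map_smul, hG, hG, hF, map_smul])
    (by
      rw [injective_iff_map_eq_zero]
      intro x hx
      obtain ⟨x, rfl⟩ := Q.mkQ_surjective x
      rw [hG, Submodule.mkQ_apply, Submodule.Quotient.mk_eq_zero, hFQ] at hx
      rwa [Submodule.mkQ_apply, Submodule.Quotient.mk_eq_zero])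
    (fun i => Q.mkQ (X i)) i₀
    (by rwa [Ne, Submodule.mkQ_apply, Submodule.Quotient.mk_eq_zero])
    (by
      intro R hR hne
      by_contra hcon
      have hle : Q ≤ R.comap Q.mkQ := fun x hx => by
        rw [Submodule.mem_comap, Submodule.mkQ_apply, (Submodule.Quotient.mk_eq_zero Q).2 hx]
        exact zero_mem R
      have hge := hmax (y := R.comap Q.mkQ) ⟨fun x => hR (Q.mkQ x), hcon⟩ hle
      refine hne (eq_bot_iff.2 fun x hx => ?_)
      obtain ⟨x, rfl⟩ := Q.mkQ_surjective x
      exact (Submodule.Quotient.mk_eq_zero Q).2 (hge hx))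
  refine ⟨z, fun h0 => hz (congrFun h0 i₀), fun m c hc => h m c ?_⟩
  simp only [hGpow, ← map_smul, ← map_sum]
  exact (Submodule.Quotient.mk_eq_zero Q).2 (hPQ hc)

end WittModule

/-! ### Teichmüller representatives and Witt coordinates. -/

namespace WittVector

variable {p : ℕ} [Fact p.Prime]

theorem eq_teichmuller_add_verschiebung {R : Type*} [CommRing R] (x : WittVector p R) :
    x = teichmuller p (x.coeff 0) + verschiebung (x.shift 1) := by
  ext n
  rw [coeff_add_of_disjoint]
  · cases n with
    | zero => rw [teichmuller_coeff_zero, verschiebung_coeff_zero, add_zero]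
    | succ n =>
      rw [teichmuller_coeff_pos _ _ _ n.succ_pos, verschiebung_coeff_succ, zero_add, shift_coeff,
        add_comm]
  · intro n
    cases n with
    | zero => right; exact verschiebung_coeff_zero _
    | succ n => left; exact teichmuller_coeff_pos _ _ _ n.succ_pos

theorem frobenius_teichmuller {R : Type*} [CommRing R] [CharP R p] (t : R) :
    frobenius (teichmuller p t) = teichmuller p (t ^ p) := by
  ext n
  rw [coeff_frobenius_charP]
  cases n with
  | zero => rw [teichmuller_coeff_zero, teichmuller_coeff_zero]
  | succ n =>
    rw [teichmuller_coeff_pos _ _ _ n.succ_pos, teichmuller_coeff_pos _ _ _ n.succ_pos,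
      zero_pow (Fact.out : p.Prime).ne_zero]

/-- Induction through `x = [x_0] + V x'` and `[t] V x' = V (F[t] x') = V ([t^p] x')`. -/
theorem coeff_teichmuller_mul {R : Type*} [CommRing R] [CharP R p] (t : R) (x : WittVector p R)
    (n : ℕ) : (teichmuller p t * x).coeff n = t ^ p ^ n * x.coeff n := by
  induction n generalizing t x with
  | zero =>
    have := map_mul (constantCoeff (p := p) (R := R)) (teichmuller p t) x
    simpa [constantCoeff] using this
  | succ n ih =>
    conv_lhs => rw [eq_teichmuller_add_verschiebung x, mul_add, ← map_mul, mul_comm _ (verschiebung _),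
      ← verschiebung_mul_frobenius, frobenius_teichmuller, mul_comm]
    rw [coeff_add_of_disjoint]
    · rw [teichmuller_coeff_pos _ _ _ n.succ_pos, verschiebung_coeff_succ, zero_add, mul_comm, ih,
        shift_coeff, ← pow_mul, ← pow_succ', add_comm 1 n]
    · intro i
      cases i with
      | zero => right; exact verschiebung_coeff_zero _
      | succ i => left; exact teichmuller_coeff_pos _ _ _ i.succ_pos

theorem map_frobenius_charP {R S : Type*} [CommRing R] [CommRing S] [CharP R p] [CharP S p]
    (f : R →+* S) (x : WittVector p R) : map f (frobenius x) = frobenius (map f x) := by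
  ext n
  simp only [map_coeff, coeff_frobenius_charP, map_pow]

end WittVector

/-! ### The filtration `fil` as a module, and Frobenius on `W_n(K)`. -/

namespace WittFil

open WittVector Polynomial

variable {p : ℕ} [Fact p.Prime] {K : Type u} [Field K]

/-- Polynomials whose coefficients `a_d` satisfy `v(a_d) ^ q ≤ exp(m) ^ d`. -/
noncomputable def boundedSubring (v : Valuation K ℤᵐ⁰) (q m : ℕ) (hq : q ≠ 0) :
    Subring K[X] where
  carrier := {f | ∀ d, v (f.coeff d) ^ q ≤ WithZero.exp (m : ℤ) ^ d}
  zero_mem' d := by simp [zero_pow hq]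
  one_mem' d := by
    rw [coeff_one]
    split_ifs with h
    · rw [h, map_one, one_pow, pow_zero]
    · simp [zero_pow hq]
  add_mem' := by
    intro f g hf hg d
    rw [coeff_add]
    rcases le_total (v (f.coeff d)) (v (g.coeff d)) with h | h
    · exact (pow_le_pow_left' (v.map_add_le h le_rfl) q).trans (hg d)
    · exact (pow_le_pow_left' (v.map_add_le le_rfl h) q).trans (hf d)
  neg_mem' := by
    intro f hf d
    rw [coeff_neg, Valuation.map_neg]
    exact hf d
  mul_mem' := by
    intro f g hf hg d
    rw [coeff_mul]
    refine Finset.sum_induction _ (fun a => v a ^ q ≤ WithZero.exp (m : ℤ) ^ d) ?_ ?_ ?_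
    · intro a b ha hb
      rcases le_total (v a) (v b) with h | h
      · exact (pow_le_pow_left' (v.map_add_le h le_rfl) q).trans hb
      · exact (pow_le_pow_left' (v.map_add_le le_rfl h) q).trans ha
    · simp [zero_pow hq]
    · intro ij hij
      rw [map_mul, mul_pow, ← Finset.HasAntidiagonal.mem_antidiagonal.1 hij, pow_add]
      exact mul_le_mul' (hf _) (hg _)

/-- Witt vectors `x` with `q * v_K(x_i) ≥ -m * p ^ i` for all `i`. -/
def filW (v : Valuation K ℤᵐ⁰) (q m : ℕ) : Set (WittVector p K) :=
  {x | ∀ i, v (x.coeff i) ^ q ≤ WithZero.exp (m : ℤ) ^ p ^ i}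

/-- The coordinates of `[X] x` are `X^{p^i} x_i`, so the weighted bounds on `x` say exactly that
`[X] x` has coordinates in one subring. Closure of `filW` under addition then follows from `W` of a
subring being a ring, without the Witt addition polynomials. -/
theorem mem_filW_iff [CharP K p] {v : Valuation K ℤᵐ⁰} {q m : ℕ} (hq : q ≠ 0)
    {x : WittVector p K} :
    x ∈ filW v q m ↔ teichmuller p (X : K[X]) * WittVector.map C x ∈
      (WittVector.map (p := p) (boundedSubring v q m hq).subtype).range := by
  have hco : ∀ i, (teichmuller p (X : K[X]) * WittVector.map C x).coeff i
      = X ^ p ^ i * C (x.coeff i) := fun i => by rw [coeff_teichmuller_mul, map_coeff]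
  constructor
  · intro hx
    refine ⟨WittVector.mk p fun i => ⟨X ^ p ^ i * C (x.coeff i), fun d => ?_⟩, ?_⟩
    · rw [coeff_X_pow_mul']
      split_ifs with h
      · rw [coeff_C]
        split_ifs with h'
        · have : d = p ^ i := by omega
          rw [this]
          exact hx i
        · simp [zero_pow hq]
      · simp [zero_pow hq]
    · ext1 i
      rw [map_coeff, hco]
      rfl
  · rintro ⟨w, hw⟩ i
    have h1 := congrArg (fun y => y.coeff i) hw
    simp only [map_coeff, hco] at h1
    have h2 := (w.coeff i).2 (p ^ i)
    have h3 : ((w.coeff i : K[X])) = X ^ p ^ i * C (x.coeff i) := h1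
    rw [h3, coeff_X_pow_mul', if_pos le_rfl, Nat.sub_self, coeff_C_zero] at h2
    exact h2

theorem add_mem_filW [CharP K p] {v : Valuation K ℤᵐ⁰} {q m : ℕ} (hq : q ≠ 0)
    {x y : WittVector p K} (hx : x ∈ filW v q m) (hy : y ∈ filW v q m) : x + y ∈ filW v q m := by
  rw [mem_filW_iff hq] at *
  rw [map_add, mul_add]
  exact add_mem hx hy

theorem neg_mem_filW [CharP K p] {v : Valuation K ℤᵐ⁰} {q m : ℕ} (hq : q ≠ 0)
    {x : WittVector p K} (hx : x ∈ filW v q m) : -x ∈ filW v q m := by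
  rw [mem_filW_iff hq] at *
  rw [map_neg, mul_neg]
  exact neg_mem hx

theorem mul_mem_filW [CharP K p] {v : Valuation K ℤᵐ⁰} {q m : ℕ} (hq : q ≠ 0)
    {c x : WittVector p K} (hc : ∀ i, v (c.coeff i) ≤ 1) (hx : x ∈ filW v q m) :
    c * x ∈ filW v q m := by
  rw [mem_filW_iff hq] at *
  rw [map_mul, mul_left_comm]
  refine mul_mem ?_ hx
  refine ⟨WittVector.mk p fun i => ⟨C (c.coeff i), fun d => ?_⟩, ?_⟩
  · rw [coeff_C]
    split_ifs with h
    · rw [h, pow_zero]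
      exact pow_le_one' (hc i) q
    · simp [zero_pow hq]
  · ext1 i
    rw [map_coeff, map_coeff]
    rfl

theorem pow_le_exp_of_pow_mul_le {a : ℤᵐ⁰} {m r s : ℕ} (hr : r ≠ 0)
    (h : a ^ (r * s) ≤ WithZero.exp (m : ℤ)) : a ^ s ≤ WithZero.exp (m : ℤ) := by
  have h1 : (1 : ℤᵐ⁰) ≤ WithZero.exp (m : ℤ) := by simp [← WithZero.exp_zero]
  rcases le_total a 1 with ha | ha
  · exact (pow_le_one' ha s).trans h1
  · exact (pow_le_pow_right' ha (Nat.le_mul_of_pos_left s (Nat.pos_of_ne_zero hr))).trans h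

theorem truncate_mem_fil {v : Valuation K ℤᵐ⁰} {n m : ℕ} {x : WittVector p K} :
    truncate n x ∈ fil v p n m ↔ ∀ i < n, v (x.coeff i) ^ p ^ (n - 1 - i) ≤ WithZero.exp (m : ℤ) := by
  simp only [fil, Set.mem_ofPred_eq, coeff_truncate]
  exact ⟨fun h i hi => h ⟨i, hi⟩, fun h i => h i i.2⟩

/-- The exponent `p^(n-1)`, the same for all coordinates, is what lets a single `boundedSubring`
describe `fil`. -/
theorem bound_iff {a : ℤᵐ⁰} {n m i : ℕ} (hi : i < n) :
    a ^ p ^ (n - 1) ≤ WithZero.exp (m : ℤ) ^ p ^ i ↔ a ^ p ^ (n - 1 - i) ≤ WithZero.exp (m : ℤ) := by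
  have : p ^ (n - 1) = p ^ (n - 1 - i) * p ^ i := by
    rw [← pow_add]
    congr 1
    omega
  rw [this, pow_mul]
  exact pow_le_pow_iff_left₀ zero_le zero_le (pow_ne_zero _ (Fact.out : p.Prime).ne_zero)

theorem truncate_mem_fil_of_mem_filW {v : Valuation K ℤᵐ⁰} {n m : ℕ} {x : WittVector p K}
    (hx : x ∈ filW v (p ^ (n - 1)) m) : truncate n x ∈ fil v p n m := by
  rw [truncate_mem_fil]
  exact fun i hi => (bound_iff hi).1 (hx i)

theorem exists_filW_of_mem_fil {v : Valuation K ℤᵐ⁰} {n m : ℕ} {x : TruncatedWittVector p n K}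
    (hx : x ∈ fil v p n m) : ∃ y ∈ filW v (p ^ (n - 1)) m, truncate n y = x := by
  have hq : p ^ (n - 1) ≠ 0 := pow_ne_zero _ (Fact.out : p.Prime).ne_zero
  refine ⟨x.out, fun i => ?_, TruncatedWittVector.truncateFun_out x⟩
  rcases lt_or_ge i n with h | h
  · rw [bound_iff h, TruncatedWittVector.coeff_out x ⟨i, h⟩]
    exact hx ⟨i, h⟩
  · have : x.out.coeff i = 0 := by
      simp [TruncatedWittVector.out, not_lt.2 h]
    rw [this, map_zero, zero_pow hq]
    exact zero_le

theorem zero_mem_fil {v : Valuation K ℤᵐ⁰} {n m : ℕ} : (0 : TruncatedWittVector p n K) ∈ fil v p n m := by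
  intro i
  rw [TruncatedWittVector.coeff_zero, map_zero, zero_pow (pow_ne_zero _ (Fact.out : p.Prime).ne_zero)]
  exact zero_le

section

variable [CharP K p] {v : Valuation K ℤᵐ⁰} {n m : ℕ}

theorem add_mem_fil {x y : TruncatedWittVector p n K} (hx : x ∈ fil v p n m)
    (hy : y ∈ fil v p n m) : x + y ∈ fil v p n m := by
  obtain ⟨x, hx', rfl⟩ := exists_filW_of_mem_fil hx
  obtain ⟨y, hy', rfl⟩ := exists_filW_of_mem_fil hy
  rw [← map_add]
  exact truncate_mem_fil_of_mem_filW
    (add_mem_filW (pow_ne_zero _ (Fact.out : p.Prime).ne_zero) hx' hy')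

theorem mul_mem_fil {c : WittVector p K} (hc : ∀ i, v (c.coeff i) ≤ 1)
    {x : TruncatedWittVector p n K} (hx : x ∈ fil v p n m) : truncate n c * x ∈ fil v p n m := by
  obtain ⟨x, hx', rfl⟩ := exists_filW_of_mem_fil hx
  rw [← map_mul]
  exact truncate_mem_fil_of_mem_filW
    (mul_mem_filW (pow_ne_zero _ (Fact.out : p.Prime).ne_zero) hc hx')

theorem neg_mem_fil {x : TruncatedWittVector p n K} (hx : x ∈ fil v p n m) :
    -x ∈ fil v p n m := by
  obtain ⟨x, hx', rfl⟩ := exists_filW_of_mem_fil hx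
  rw [← map_neg]
  exact truncate_mem_fil_of_mem_filW
    (neg_mem_filW (pow_ne_zero _ (Fact.out : p.Prime).ne_zero) hx')

theorem sub_mem_fil {x y : TruncatedWittVector p n K} (hx : x ∈ fil v p n m)
    (hy : y ∈ fil v p n m) : x - y ∈ fil v p n m := by
  rw [sub_eq_add_neg]
  exact add_mem_fil hx (neg_mem_fil hy)

theorem frob_truncate (x : WittVector p K) :
    frob p (truncate n x) = truncate n (WittVector.frobenius x) := by
  ext i
  rw [coeff_truncate, coeff_frobenius_charP, frob, TruncatedWittVector.coeff_mk, coeff_truncate]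

/-- The Frobenius of `W_n(K)` as a ring endomorphism. -/
noncomputable def frobHom : TruncatedWittVector p n K →+* TruncatedWittVector p n K where
  toFun := frob p
  map_one' := by
    rw [← map_one (truncate n), frob_truncate, map_one]
  map_zero' := by
    rw [← map_zero (truncate n), frob_truncate, map_zero]
  map_add' x y := by
    obtain ⟨x, rfl⟩ := truncate_surjective p n K x
    obtain ⟨y, rfl⟩ := truncate_surjective p n K y
    simp only [← map_add, frob_truncate]
  map_mul' x y := by
    obtain ⟨x, rfl⟩ := truncate_surjective p n K x
    obtain ⟨y, rfl⟩ := truncate_surjective p n K y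
    simp only [← map_mul, frob_truncate]

theorem coe_frobHom : ⇑(frobHom : TruncatedWittVector p n K →+* _) = frob p := rfl

theorem frob_injective : Function.Injective (frob p : TruncatedWittVector p n K → _) := by
  intro x y h
  ext i
  have := congrArg (TruncatedWittVector.coeff i) h
  simp only [frob, TruncatedWittVector.coeff_mk] at this
  exact frobenius_inj K p this

end

end WittFil

/-! ### Stability of `filF` under Frobenius, `W(k)` and Verschiebung. -/

namespace WittFil

open WittVector

variable {p : ℕ} [Fact p.Prime] {K : Type u} [Field K]

variable {v : Valuation K ℤᵐ⁰} {n m : ℕ}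

theorem zero_mem_filF : (0 : TruncatedWittVector p n K) ∈ filF v p n m :=
  ⟨0, fun _ => 0, fun _ => zero_mem_fil, by simp⟩

theorem fil_subset_filF {x : TruncatedWittVector p n K} (hx : x ∈ fil v p n m) :
    x ∈ filF v p n m :=
  ⟨1, fun _ => x, fun _ => hx, by simp⟩

theorem truncate_verschiebung_congr {R : Type*} [CommRing R] {x y : WittVector p R} (a n : ℕ)
    (h : truncate n x = truncate n y) :
    truncate (n + a) (verschiebung^[a] x) = truncate (n + a) (verschiebung^[a] y) := by
  ext ⟨i, hi⟩
  rw [coeff_truncate, coeff_truncate]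
  rcases lt_or_ge i a with h' | h'
  · simp only [iterate_verschiebung_coeff_eq_zero _ h']
  · obtain ⟨j, rfl⟩ := Nat.exists_eq_add_of_le' h'
    simp only [iterate_verschiebung_coeff]
    have := congrArg (TruncatedWittVector.coeff ⟨j, by omega⟩) h
    rwa [coeff_truncate, coeff_truncate] at this

theorem truncate_verschiebung_injective {R : Type*} [CommRing R] {x y : WittVector p R} (a n : ℕ)
    (h : truncate (n + a) (verschiebung^[a] x) = truncate (n + a) (verschiebung^[a] y)) :
    truncate n x = truncate n y := by
  ext ⟨i, hi⟩
  have := congrArg (TruncatedWittVector.coeff ⟨i + a, by omega⟩) h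
  simpa only [coeff_truncate, iterate_verschiebung_coeff] using this

theorem exists_truncate_verschiebung_eq {R : Type*} [CommRing R]
    (x : TruncatedWittVector p (n + 1) R) (hx : x.coeff 0 = 0) :
    ∃ y : WittVector p R, truncate (n + 1) (verschiebung y) = x := by
  obtain ⟨x, rfl⟩ := truncate_surjective p (n + 1) R x
  refine ⟨x.shift 1, ?_⟩
  rw [coeff_truncate] at hx
  conv_rhs => rw [eq_teichmuller_add_verschiebung x]
  have : x.coeff 0 = 0 := hx
  rw [this, teichmuller_zero, zero_add]

theorem coeff_zero_add {R : Type*} [CommRing R] (x y : TruncatedWittVector p (n + 1) R) :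
    (x + y).coeff 0 = x.coeff 0 + y.coeff 0 := by
  obtain ⟨x, rfl⟩ := truncate_surjective p (n + 1) R x
  obtain ⟨y, rfl⟩ := truncate_surjective p (n + 1) R y
  rw [← map_add, coeff_truncate, coeff_truncate, coeff_truncate]
  exact map_add constantCoeff x y

theorem truncate_mem_fil_iff_verschiebung (x : WittVector p K) :
    truncate n x ∈ fil v p n m ↔ truncate (n + 1) (verschiebung x) ∈ fil v p (n + 1) m := by
  rw [truncate_mem_fil, truncate_mem_fil]
  constructor
  · intro h i hi
    cases i with
    | zero =>
      rw [verschiebung_coeff_zero, map_zero,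
        zero_pow (pow_ne_zero _ (Fact.out : p.Prime).ne_zero)]
      exact zero_le
    | succ i =>
      have := h i (by omega)
      rwa [verschiebung_coeff_succ, show n + 1 - 1 - (i + 1) = n - 1 - i by omega]
  · intro h i hi
    have := h (i + 1) (by omega)
    rwa [verschiebung_coeff_add_one, show n + 1 - 1 - (i + 1) = n - 1 - i by omega] at this

theorem teichmuller_mem_fil {b : K} (hb : v b ^ p ^ n ≤ WithZero.exp (m : ℤ)) :
    truncate (n + 1) (teichmuller p b) ∈ fil v p (n + 1) m := by
  rw [truncate_mem_fil]
  intro i _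
  cases i with
  | zero => rwa [teichmuller_coeff_zero]
  | succ i =>
    rw [teichmuller_coeff_pos _ _ _ i.succ_pos, map_zero,
      zero_pow (pow_ne_zero _ (Fact.out : p.Prime).ne_zero)]
    exact zero_le

variable [CharP K p]

theorem frob_iterate_eq (j : ℕ) (x : TruncatedWittVector p n K) :
    (frob p)^[j] x = (frobHom ^ j : TruncatedWittVector p n K →+* _) x := by
  rw [RingHom.coe_pow, coe_frobHom]

theorem frob_iterate_zero (j : ℕ) : (frob p)^[j] (0 : TruncatedWittVector p n K) = 0 := by
  rw [frob_iterate_eq, map_zero]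

theorem frob_iterate_add (j : ℕ) (x y : TruncatedWittVector p n K) :
    (frob p)^[j] (x + y) = (frob p)^[j] x + (frob p)^[j] y := by
  simp only [frob_iterate_eq, map_add]

theorem frob_sum {ι : Type*} (s : Finset ι) (f : ι → TruncatedWittVector p n K) :
    frob p (∑ i ∈ s, f i) = ∑ i ∈ s, frob p (f i) := map_sum frobHom f s

theorem sum_frob_iterate_succ (N : ℕ) (y : ℕ → TruncatedWittVector p n K) :
    ∑ j ∈ Finset.range (N + 1), (frob p)^[j] (y j)
      = y 0 + frob p (∑ j ∈ Finset.range N, (frob p)^[j] (y (j + 1))) := by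
  rw [Finset.sum_range_succ', frob_sum, add_comm]
  simp only [Function.iterate_succ', Function.comp_apply, Function.iterate_zero, id]

theorem add_mem_filF {x y : TruncatedWittVector p n K} (hx : x ∈ filF v p n m)
    (hy : y ∈ filF v p n m) : x + y ∈ filF v p n m := by
  have key : ∀ (N M : ℕ) (f : ℕ → TruncatedWittVector p n K), N ≤ M →
      ∑ j ∈ Finset.range M, (frob p)^[j] (if j < N then f j else 0)
        = ∑ j ∈ Finset.range N, (frob p)^[j] (f j) := by
    intro N M f h
    rw [← Finset.sum_subset (Finset.range_mono h)]
    · exact Finset.sum_congr rfl fun j hj => by rw [if_pos (Finset.mem_range.1 hj)]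
    · intro j _ hj
      rw [if_neg (by simpa using hj), frob_iterate_zero]
  obtain ⟨N, f, hf, rfl⟩ := hx
  obtain ⟨M, g, hg, rfl⟩ := hy
  refine ⟨max N M, fun j => (if j < N then f j else 0) + (if j < M then g j else 0),
    fun j => ?_, ?_⟩
  · refine add_mem_fil ?_ ?_ <;> split_ifs
    exacts [hf j, zero_mem_fil, hg j, zero_mem_fil]
  · simp only [frob_iterate_add, Finset.sum_add_distrib]
    rw [key _ _ _ (le_max_left N M), key _ _ _ (le_max_right N M)]

theorem frob_mem_filF {x : TruncatedWittVector p n K} (hx : x ∈ filF v p n m) :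
    frob p x ∈ filF v p n m := by
  obtain ⟨N, y, hy, rfl⟩ := hx
  refine ⟨N + 1, fun j => if j = 0 then 0 else y (j - 1), fun j => ?_, ?_⟩
  · dsimp only
    split_ifs
    exacts [zero_mem_fil, hy _]
  · rw [sum_frob_iterate_succ]
    simp

/-- Write `F x = y_0 + F z`. Then `F (x - z) = y_0` lies in `fil`, and so does `x - z`, because for
`m ≥ 0` taking `p`-th roots of coordinates preserves the bounds. -/
theorem mem_filF_of_frob_mem {x : TruncatedWittVector p n K} (hx : frob p x ∈ filF v p n m) :
    x ∈ filF v p n m := by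
  obtain ⟨N, y, hy, hxy⟩ := hx
  cases N with
  | zero =>
    rw [Finset.sum_range_zero, ← frob_iterate_zero 1] at hxy
    rw [frob_injective hxy]
    exact zero_mem_filF
  | succ N =>
    rw [sum_frob_iterate_succ] at hxy
    set z := ∑ j ∈ Finset.range N, (frob p)^[j] (y (j + 1)) with hz
    have h1 : frob p (x - z) = y 0 := by
      have : frob p (x - z) = frob p x - frob p z := map_sub frobHom x z
      rw [this, hxy, add_sub_cancel_right]
    have h2 : x - z ∈ fil v p n m := by
      intro i
      have := hy 0 i
      rw [← h1, frob, TruncatedWittVector.coeff_mk, map_pow, ← pow_mul] at this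
      exact pow_le_exp_of_pow_mul_le (Fact.out : p.Prime).ne_zero this
    rw [← sub_add_cancel x z]
    exact add_mem_filF (fil_subset_filF h2) ⟨N, _, fun j => hy (j + 1), hz⟩

/-- Scalars pass through Frobenius by `c F(w) = F(F⁻¹(c) w)`, where `F` is bijective on `W(k)` for
perfect `k`; integrality of `k` handles the term in `fil`. -/
theorem map_mul_mem_filF {k : Type*} [Field k] [CharP k p] [PerfectRing k p] [Algebra k K]
    (hk : ∀ a : k, v (algebraMap k K a) ≤ 1) (c : WittVector p k)
    {x : TruncatedWittVector p n K} (hx : x ∈ filF v p n m) :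
    truncate n (WittVector.map (algebraMap k K) c) * x ∈ filF v p n m := by
  obtain ⟨N, y, hy, rfl⟩ := hx
  induction N generalizing c y with
  | zero => simpa using zero_mem_filF
  | succ N ih =>
    rw [sum_frob_iterate_succ, mul_add]
    refine add_mem_filF (fil_subset_filF (mul_mem_fil (fun i => ?_) (hy 0))) ?_
    · rw [map_coeff]
      exact hk _
    · obtain ⟨c, rfl⟩ := (WittVector.frobenius_bijective p k).surjective c
      rw [map_frobenius_charP, ← frob_truncate, ← coe_frobHom, ← map_mul, coe_frobHom]
      exact frob_mem_filF (ih c _ fun j => hy (j + 1))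

/-- In `V x = y_0 + F z` the first coordinates cancel: that of `y_0` is `-b^p`, with `b` that of
`z`. Hence `b` satisfies the bound, and `V x = (y_0 + [b^p]) + F(z - [b])` splits into two vectors
in the image of `V`; induction treats the second. -/
theorem truncate_mem_filF_of_verschiebung (x : WittVector p K)
    (hx : truncate (n + 1) (verschiebung x) ∈ filF v p (n + 1) m) :
    truncate n x ∈ filF v p n m := by
  obtain ⟨N, y, hy, hxy⟩ := hx
  induction N generalizing x y with
  | zero =>
    rw [Finset.sum_range_zero, ← map_zero (truncate (n + 1)),
      ← map_zero (verschiebung (p := p) (R := K))] at hxy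
    rw [truncate_verschiebung_injective 1 n hxy, map_zero]
    exact zero_mem_filF
  | succ N ih =>
    rw [sum_frob_iterate_succ] at hxy
    set z := ∑ j ∈ Finset.range N, (frob p)^[j] (y (j + 1)) with hz
    set b := z.coeff 0 with hb
    have hp := (Fact.out : p.Prime)
    have h0 : (y 0).coeff 0 + b ^ p = 0 := by
      have := congrArg (TruncatedWittVector.coeff 0) hxy
      rw [coeff_zero_add, coeff_truncate] at this
      exact this.symm.trans (verschiebung_coeff_zero x)
    have hvb : v b ^ p ^ n ≤ WithZero.exp (m : ℤ) := by
      refine pow_le_exp_of_pow_mul_le (r := p) hp.ne_zero ?_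
      have h1 := hy 0 0
      rw [eq_neg_of_add_eq_zero_left h0, Valuation.map_neg, map_pow, ← pow_mul] at h1
      exact h1
    have hvbp : v (b ^ p) ^ p ^ n ≤ WithZero.exp (m : ℤ) := by
      have h1 := hy 0 0
      rw [eq_neg_of_add_eq_zero_left h0, Valuation.map_neg] at h1
      exact h1
    obtain ⟨u, hu⟩ := exists_truncate_verschiebung_eq
      (y 0 + truncate (n + 1) (teichmuller p (b ^ p))) (by
        rw [coeff_zero_add, coeff_truncate]
        exact (congrArg _ (teichmuller_coeff_zero p _)).trans h0)
    have hu' : truncate n u ∈ fil v p n m := by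
      rw [truncate_mem_fil_iff_verschiebung, hu]
      exact add_mem_fil (hy 0) (teichmuller_mem_fil hvbp)
    obtain ⟨w, hw⟩ := exists_truncate_verschiebung_eq
      (z - truncate (n + 1) (teichmuller p b)) (by
        have := coeff_zero_add (z - truncate (n + 1) (teichmuller p b))
          (truncate (n + 1) (teichmuller p b))
        rw [sub_add_cancel, coeff_truncate] at this
        have h2 : (teichmuller p b).coeff ((0 : Fin (n + 1)) : ℕ) = b := teichmuller_coeff_zero p b
        rw [h2, ← hb] at this
        exact right_eq_add.1 this)
    have hw' : truncate n w ∈ filF v p n m := by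
      -- The correction `-[b]` is absorbed in the term `y 1`. An empty sum has no such term, but
      -- then `b = 0`.
      rcases Nat.eq_zero_or_pos N with rfl | hN
      · have hz0 : z = 0 := by rw [hz, Finset.sum_range_zero]
        have hb0 : b = 0 := by rw [hb, hz0, TruncatedWittVector.coeff_zero]
        refine ih w (fun _ => 0) (fun _ => zero_mem_fil) ?_
        rw [hw, hz0, hb0, teichmuller_zero, map_zero, sub_zero, Finset.sum_range_zero]
      · obtain ⟨N, rfl⟩ : ∃ N', N = N' + 1 := ⟨N - 1, by omega⟩
        refine ih w (fun j => if j = 0 then y 1 - truncate (n + 1) (teichmuller p b)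
          else y (j + 1)) (fun j => ?_) ?_
        · split_ifs
          exacts [sub_mem_fil (hy 1) (teichmuller_mem_fil hvb), hy _]
        · rw [hw, hz, sum_frob_iterate_succ, sum_frob_iterate_succ]
          simp [sub_add_eq_add_sub]
    have hx' : truncate n x = truncate n (u + WittVector.frobenius w) := by
      refine truncate_verschiebung_injective 1 n ?_
      simp only [Function.iterate_one]
      rw [hxy, map_add, verschiebung_frobenius_comm, map_add, hu, ← frob_truncate, hw]
      have h3 : frob p (z - truncate (n + 1) (teichmuller p b))
          = frob p z - frob p (truncate (n + 1) (teichmuller p b)) := map_sub frobHom _ _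
      rw [h3, frob_truncate, frobenius_teichmuller]
      ring
    rw [hx', map_add, ← frob_truncate]
    exact add_mem_filF (fil_subset_filF hu') (frob_mem_filF hw')

/-- `V` respects `fil` and commutes with `F` in characteristic `p`. -/
theorem truncate_verschiebung_mem_filF (x : WittVector p K)
    (hx : truncate n x ∈ filF v p n m) :
    truncate (n + 1) (verschiebung x) ∈ filF v p (n + 1) m := by
  obtain ⟨N, y, hy, hxy⟩ := hx
  induction N generalizing x y with
  | zero =>
    rw [Finset.sum_range_zero, ← map_zero (truncate n)] at hxy
    have := truncate_verschiebung_congr 1 n hxy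
    rw [Function.iterate_one] at this
    rw [this, map_zero, map_zero]
    exact zero_mem_filF
  | succ N ih =>
    rw [sum_frob_iterate_succ] at hxy
    obtain ⟨u, hu⟩ := truncate_surjective p n K (y 0)
    obtain ⟨w, hw⟩ := truncate_surjective p n K
      (∑ j ∈ Finset.range N, (frob p)^[j] (y (j + 1)))
    rw [← hu, ← hw, frob_truncate, ← map_add] at hxy
    have := truncate_verschiebung_congr 1 n hxy
    rw [Function.iterate_one] at this
    rw [this, map_add, map_add, verschiebung_frobenius_comm, ← frob_truncate]
    refine add_mem_filF (fil_subset_filF ?_) (frob_mem_filF (ih w _ (fun j => hy (j + 1)) hw))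
    rw [← truncate_mem_fil_iff_verschiebung, hu]
    exact hy 0

theorem truncate_mem_filF_iff (a : ℕ) (x : WittVector p K) :
    truncate (n + a) (verschiebung^[a] x) ∈ filF v p (n + a) m ↔ truncate n x ∈ filF v p n m := by
  induction a with
  | zero => rfl
  | succ a ih =>
    rw [← ih, Function.iterate_succ_apply']
    exact ⟨truncate_mem_filF_of_verschiebung _, truncate_verschiebung_mem_filF _⟩

end WittFil

/-! ### Additive polynomials in characteristic `p`. -/

section AdditivePolynomial

open Polynomial

variable {k : Type u} [Field k] {p : ℕ} [Fact p.Prime] [CharP k p]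

/-- Compare mixed coefficients in `f(X + Y) = f(X) + f(Y)`, the left side being expanded by Hasse
derivatives. -/
theorem Polynomial.coeff_mul_choose_eq_zero_of_additive {f : k[X]}
    (hf : aeval (X + C X : k[X][X]) f = aeval (X : k[X][X]) f + aeval (C X : k[X][X]) f)
    {n i : ℕ} (hn : n ≠ 0) (hi : i ≠ 0) : ((i + n).choose n : k) * f.coeff (i + n) = 0 := by
  have h1 : aeval (X + C X : k[X][X]) f = taylor X (f.map C) := by
    rw [taylor_apply, comp, eval₂_map, aeval_def]
    rfl
  have h2 : aeval (X : k[X][X]) f = f.map C := by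
    rw [aeval_def]; rfl
  have h3 : aeval (C X : k[X][X]) f = C f := by
    rw [← algebraMap_eq (R := k[X]), aeval_algebraMap_apply, aeval_X_left_apply]
  rw [h1, h2, h3] at hf
  have h4 := congrArg (fun g => coeff g n) hf
  simp only [taylor_coeff, coeff_add, coeff_map, coeff_C, if_neg hn, add_zero] at h4
  have h5 : hasseDeriv n (f.map C) = (hasseDeriv n f).map (C : k →+* k[X]) := by
    ext1 j
    rw [hasseDeriv_coeff, coeff_map, coeff_map, hasseDeriv_coeff, map_mul, map_natCast]
  rw [h5, eval_map, eval₂_C_X] at h4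
  have h6 := congrArg (fun g => coeff g i) h4
  simpa only [hasseDeriv_coeff, coeff_C, if_neg hi] using h6

/-- If `f.coeff m ≠ 0`, all inner binomial coefficients of `m` vanish modulo `p`, which forces `m`
to be a power of `p`. -/
theorem Polynomial.aeval_eq_sum_pow_of_additive {f : k[X]}
    (hf : aeval (X + C X : k[X][X]) f = aeval (X : k[X][X]) f + aeval (C X : k[X][X]) f)
    (hf0 : f.coeff 0 = 0) {M : ℕ} (hM : f.natDegree < M) {R : Type*} [CommRing R] [Algebra k R]
    (r : R) : aeval r f = ∑ l ∈ Finset.range M, algebraMap k R (f.coeff (p ^ l)) * r ^ p ^ l := by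
  have hp := (Fact.out : p.Prime)
  have hsupp : ∀ m, f.coeff m ≠ 0 → ∃ l, m = p ^ l := by
    intro m hm
    have hm0 : 0 < m := Nat.pos_of_ne_zero fun h => hm (h ▸ hf0)
    refine ⟨_, Choose.eq_pow_multiplicity_of_choose_modEq_zero_nat (p := p) hm0 fun i hi => ?_⟩
    rw [Finset.mem_Icc] at hi
    have h1 := coeff_mul_choose_eq_zero_of_additive hf (n := i) (i := m - i) (by omega) (by omega)
    rw [Nat.sub_add_cancel (by omega)] at h1
    exact (Nat.modEq_zero_iff_dvd).2
      ((CharP.cast_eq_zero_iff k p _).1 ((mul_eq_zero.1 h1).resolve_right hm))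
  have hlt : f.natDegree < p ^ M := hM.trans (Nat.lt_pow_self hp.one_lt)
  have hinj : Function.Injective fun l : ℕ => p ^ l := Nat.pow_right_injective hp.two_le
  rw [aeval_eq_sum_range' hlt, ← Finset.sum_image (g := fun l => p ^ l)
    (f := fun i => algebraMap k R (f.coeff i) * r ^ i) fun a _ b _ h => hinj h]
  simp only [Algebra.smul_def]
  symm
  refine Finset.sum_subset ?_ ?_
  · intro i hi
    obtain ⟨l, hl, rfl⟩ := Finset.mem_image.1 hi
    exact Finset.mem_range.2 (Nat.pow_lt_pow_right hp.one_lt (Finset.mem_range.1 hl))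
  · intro i hi hi'
    have : f.coeff i = 0 := by
      by_contra h
      obtain ⟨l, rfl⟩ := hsupp i h
      exact hi' (Finset.mem_image.2 ⟨l, Finset.mem_range.2
        ((Nat.pow_lt_pow_iff_right hp.one_lt).1 (Finset.mem_range.1 hi)), rfl⟩)
    rw [this, map_zero, zero_mul]

end AdditivePolynomial

/-! ### Natural homomorphisms from `W` to `W_N`. -/

namespace WittFil

open WittVector

variable {p : ℕ} [Fact p.Prime]

theorem mapW_truncate {R S : Type u} [CommRing R] [CommRing S] (f : R →+* S) {n : ℕ}
    (x : WittVector p R) : mapW p f (truncate n x) = truncate n (WittVector.map f x) := by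
  ext i
  rw [coeff_truncate, map_coeff, mapW, TruncatedWittVector.coeff_mk, coeff_truncate]

theorem map_verschiebung_iterate {R S : Type*} [CommRing R] [CommRing S] (f : R →+* S) (n : ℕ)
    (x : WittVector p R) :
    WittVector.map f (verschiebung^[n] x) = verschiebung^[n] (WittVector.map f x) := by
  induction n with
  | zero => rfl
  | succ n ih => rw [Function.iterate_succ_apply', map_verschiebung, ih, Function.iterate_succ_apply']

theorem map_frobenius_iterate {R S : Type u} [CommRing R] [CommRing S] (f : R →+* S) (n : ℕ)
    (x : WittVector p R) :
    WittVector.map f (WittVector.frobenius^[n] x) = WittVector.frobenius^[n] (WittVector.map f x) := by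
  induction n with
  | zero => rfl
  | succ n ih =>
    rw [Function.iterate_succ_apply', (frobenius_isPoly p).map, ih,
      Function.iterate_succ_apply']

theorem teichmuller_add_eq {R : Type*} [CommRing R] (a b : R) :
    ∃ w, teichmuller p a + teichmuller p b = teichmuller p (a + b) + verschiebung w := by
  have h : (teichmuller p a + teichmuller p b).coeff 0 = a + b := by
    change constantCoeff (teichmuller p a + teichmuller p b) = _
    rw [map_add]
    exact congrArg₂ (· + ·) (teichmuller_coeff_zero p a) (teichmuller_coeff_zero p b)
  have := eq_teichmuller_add_verschiebung (teichmuller p a + teichmuller p b)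
  rw [h] at this
  exact ⟨_, this⟩

/-- A homomorphism from the group of Witt vectors to the group of Witt vectors of length `N`,
natural in the `k`-algebra. -/
structure WittNatHom (p : ℕ) [Fact p.Prime] (k : Type u) [Field k] (N : ℕ) where
  /-- the map on `R`-points -/
  app : ∀ (R : Type u) [CommRing R] [Algebra k R], WittVector p R →+ TruncatedWittVector p N R
  naturality : ∀ (R S : Type u) [CommRing R] [CommRing S] [Algebra k R] [Algebra k S]
    (f : R →ₐ[k] S) (x : WittVector p R),
    app S (WittVector.map (f : R →+* S) x) = mapW p f (app R x)

variable {k : Type u} [Field k]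

/-- The `k`-homomorphism `x ↦ ∑_{l < M} c_l F^l (V^a x)`, truncated to length `N`. -/
noncomputable def WittNatHom.ofCoeff (N a M : ℕ) (c : ℕ → WittVector p k) :
    WittNatHom p k N where
  app R _ _ := AddMonoidHom.mk' (fun x => truncate N (∑ l ∈ Finset.range M,
      WittVector.map (algebraMap k R) (c l) * WittVector.frobenius^[l] (verschiebung^[a] x)))
    fun x y => by
      simp only [iterate_map_add, mul_add, Finset.sum_add_distrib, map_add]
  naturality R S _ _ _ _ f x := by
    simp only [AddMonoidHom.mk'_apply]
    change _ = mapW p (f : R →+* S) _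
    rw [mapW_truncate, map_sum (WittVector.map (f : R →+* S))]
    congr 1
    refine Finset.sum_congr rfl fun l _ => ?_
    rw [map_mul, map_frobenius_iterate, map_verschiebung_iterate]
    congr 1
    ext1 i
    simp only [map_coeff]
    exact (f.commutes _).symm

theorem WittNatHom.ofCoeff_apply (N a M : ℕ) (c : ℕ → WittVector p k) (R : Type u) [CommRing R]
    [Algebra k R] (x : WittVector p R) :
    (WittNatHom.ofCoeff N a M c).app R x = truncate N (∑ l ∈ Finset.range M,
      WittVector.map (algebraMap k R) (c l) * WittVector.frobenius^[l] (verschiebung^[a] x)) :=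
  rfl

/-- The difference of two natural homomorphisms. -/
noncomputable def WittNatHom.sub {N : ℕ} (h g : WittNatHom p k N) : WittNatHom p k N where
  app R _ _ := h.app R - g.app R
  naturality R S _ _ _ _ f x := by
    obtain ⟨u, hu⟩ := truncate_surjective p N R (h.app R x)
    obtain ⟨w, hw⟩ := truncate_surjective p N R (g.app R x)
    rw [AddMonoidHom.sub_apply, AddMonoidHom.sub_apply, h.naturality, g.naturality, ← hu, ← hw,
      ← map_sub]
    change mapW p (f : R →+* S) _ - mapW p (f : R →+* S) _ = mapW p (f : R →+* S) _
    rw [mapW_truncate, mapW_truncate, mapW_truncate, map_sub, map_sub]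

end WittFil

/-! ### Natural homomorphisms as polynomials in Frobenius. -/

namespace WittFil

open WittVector Polynomial

variable {p : ℕ} [Fact p.Prime] {k : Type u} [Field k] {N n : ℕ}

theorem verschiebung_iterate_frobenius_iterate {R : Type*} [CommRing R] [CharP R p] (i j : ℕ)
    (x : WittVector p R) :
    verschiebung^[i] (WittVector.frobenius^[j] x) = WittVector.frobenius^[j] (verschiebung^[i] x) := by
  have h : Function.Commute (verschiebung : WittVector p R → _) WittVector.frobenius :=
    fun x => verschiebung_frobenius_comm x
  exact (h.iterate_iterate i j) x

theorem frob_iterate_truncate {L : Type*} [Field L] [CharP L p] (j : ℕ) (y : WittVector p L) :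
    (frob p)^[j] (truncate n y) = truncate n (WittVector.frobenius^[j] y) := by
  induction j with
  | zero => rfl
  | succ j ih => rw [Function.iterate_succ_apply', ih, frob_truncate, Function.iterate_succ_apply']

theorem frobenius_iterate_teichmuller {R : Type*} [CommRing R] [CharP R p] (j : ℕ) (r : R) :
    WittVector.frobenius^[j] (teichmuller p r) = teichmuller p (r ^ p ^ j) := by
  induction j with
  | zero => simp
  | succ j ih => rw [Function.iterate_succ_apply', ih, frobenius_teichmuller, ← pow_mul, ← pow_succ]

theorem verschiebung_iterate_sum {R ι : Type*} [CommRing R] (s : Finset ι) (f : ι → WittVector p R)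
    (n : ℕ) : verschiebung^[n] (∑ i ∈ s, f i) = ∑ i ∈ s, verschiebung^[n] (f i) := by
  induction n with
  | zero => rfl
  | succ n ih => simp only [Function.iterate_succ_apply', ih, map_sum]

theorem p_nsmul_verschiebung_iterate {R : Type*} [CommRing R] [CharP R p] (n : ℕ)
    (x : WittVector p R) :
    p • verschiebung^[n] x = verschiebung^[n + 1] (WittVector.frobenius x) := by
  have := verschiebung_iterate_frobenius_iterate n 1 x
  rw [Function.iterate_one] at this
  rw [nsmul_eq_mul, mul_comm, ← verschiebung_frobenius, ← this, Function.iterate_succ_apply']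

theorem coeff_verschiebung_iterate_self {R : Type*} [CommRing R] (N : ℕ) (x : WittVector p R) :
    (verschiebung^[N] x).coeff N = x.coeff 0 := by
  have := iterate_verschiebung_coeff x N 0
  rwa [zero_add] at this

theorem truncate_verschiebung_iterate_congr {R : Type*} [CommRing R] {x y : WittVector p R}
    (h : x.coeff 0 = y.coeff 0) :
    truncate (N + 1) (verschiebung^[N] x) = truncate (N + 1) (verschiebung^[N] y) := by
  ext ⟨i, hi⟩
  rw [coeff_truncate, coeff_truncate]
  rcases (Nat.le_of_lt_succ hi).lt_or_eq with h' | rfl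
  · simp only [iterate_verschiebung_coeff_eq_zero _ h']
  · simp only [coeff_verschiebung_iterate_self, h]

theorem coeff_zero_eq_of_truncate_verschiebung_iterate {R : Type*} [CommRing R]
    {x y : WittVector p R}
    (h : truncate (N + 1) (verschiebung^[N] x) = truncate (N + 1) (verschiebung^[N] y)) :
    x.coeff 0 = y.coeff 0 := by
  have := congrArg (TruncatedWittVector.coeff (Fin.last N)) h
  simpa only [coeff_truncate, Fin.val_last, coeff_verschiebung_iterate_self] using this

/-- A truncated Witt vector over a reduced ring that is killed by `p` is concentrated in the last
coordinate. -/
theorem eq_truncate_verschiebung_of_p_nsmul_eq_zero {R : Type*} [CommRing R] [CharP R p]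
    [IsReduced R] (z : TruncatedWittVector p (N + 1) R) (hz : p • z = 0) :
    z = truncate (N + 1) (verschiebung^[N] (teichmuller p (z.coeff (Fin.last N)))) := by
  obtain ⟨x, rfl⟩ := truncate_surjective p (N + 1) R z
  have hx : ∀ i < N, x.coeff i = 0 := by
    intro i hi
    have h1 : p • truncate (N + 1) x = truncate (N + 1) (x * (p : WittVector p R)) := by
      rw [nsmul_eq_mul, mul_comm, map_mul, map_natCast]
    rw [h1] at hz
    have h2 := congrArg (TruncatedWittVector.coeff ⟨i + 1, by omega⟩) hz
    rw [coeff_truncate, TruncatedWittVector.coeff_zero] at h2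
    -- Coordinate `i + 1` of `p x` is `x_i^p`, so reducedness gives `x_i = 0`.
    rw [mul_charP_coeff_succ] at h2
    exact eq_zero_of_pow_eq_zero h2
  ext ⟨i, hi⟩
  rw [coeff_truncate, coeff_truncate, coeff_truncate, Fin.val_last]
  rcases (Nat.le_of_lt_succ hi).lt_or_eq with h' | rfl
  · simp only [iterate_verschiebung_coeff_eq_zero _ h', hx i h']
  · simp only [coeff_verschiebung_iterate_self, teichmuller_coeff_zero]

/-- By naturality it suffices to treat the universal element `V^n [X]` over `k[X]`. Since `p V^n [X]
= V^{n+1} F [X]` is killed by `h`, its image is `p`-torsion over a reduced ring, hence lives in the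
last coordinate. -/
theorem WittNatHom.exists_polynomial [CharP k p] (h : WittNatHom p k (N + 1))
    (hh : ∀ (R : Type u) [CommRing R] [Algebra k R] (x : WittVector p R),
      h.app R (verschiebung^[n + 1] x) = 0) :
    ∃ f : k[X], ∀ (R : Type u) [CommRing R] [Algebra k R] (r : R),
      h.app R (verschiebung^[n] (teichmuller p r))
        = truncate (N + 1) (verschiebung^[N] (teichmuller p (aeval r f))) := by
  set z := h.app k[X] (verschiebung^[n] (teichmuller p X)) with hz
  have hpz : p • z = 0 := by
    rw [hz, ← map_nsmul, p_nsmul_verschiebung_iterate, hh]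
  refine ⟨z.coeff (Fin.last N), fun R _ _ r => ?_⟩
  have h1 := h.naturality k[X] R (aeval r) (verschiebung^[n] (teichmuller p X))
  rw [map_verschiebung_iterate, map_teichmuller, ← hz] at h1
  have h2 : ((aeval r : k[X] →ₐ[k] R) : k[X] →+* R) X = r := aeval_X r
  rw [h2] at h1
  rw [h1]
  conv_lhs => rw [eq_truncate_verschiebung_of_p_nsmul_eq_zero z hpz]
  change mapW p ((aeval r : k[X] →ₐ[k] R) : k[X] →+* R) _ = _
  rw [mapW_truncate, map_verschiebung_iterate, map_teichmuller]
  rfl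

/-- The sum `[a] + [b]` equals `[a + b]` up to `V W`, which `h V^n` kills, so the polynomial
describing `h V^n` is additive. -/
theorem WittNatHom.exists_leading_coeff [CharP k p] (h : WittNatHom p k (N + 1))
    (hh : ∀ (R : Type u) [CommRing R] [Algebra k R] (x : WittVector p R),
      h.app R (verschiebung^[n + 1] x) = 0) :
    ∃ (M : ℕ) (a : ℕ → k), (∀ l, M ≤ l → a l = 0) ∧
      ∀ (R : Type u) [CommRing R] [Algebra k R] (x : WittVector p R),
      h.app R (verschiebung^[n] x) = truncate (N + 1) (verschiebung^[N] (teichmuller p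
        (∑ l ∈ Finset.range M, algebraMap k R (a l) * x.coeff 0 ^ p ^ l))) := by
  obtain ⟨f, hf⟩ := h.exists_polynomial hh
  have hadd : ∀ (R : Type u) [CommRing R] [Algebra k R] (a b : R),
      aeval (a + b) f = aeval a f + aeval b f := by
    intro R _ _ a b
    obtain ⟨w, hw⟩ := teichmuller_add_eq (p := p) a b
    have h1 := congrArg (fun x => h.app R (verschiebung^[n] x)) hw
    simp only [iterate_map_add, map_add] at h1
    rw [← Function.iterate_succ_apply, hh, add_zero, hf, hf, hf, ← map_add, ← iterate_map_add]
      at h1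
    have h2 := coeff_zero_eq_of_truncate_verschiebung_iterate h1
    rw [teichmuller_coeff_zero] at h2
    rw [← h2]
    change WittVector.constantCoeff (teichmuller p (aeval a f) + teichmuller p (aeval b f)) = _
    rw [map_add]
    exact congrArg₂ (· + ·) (teichmuller_coeff_zero p _) (teichmuller_coeff_zero p _)
  have hf0 : f.coeff 0 = 0 := by
    have := hadd k 0 0
    rw [add_zero, coe_aeval_eq_eval, ← coeff_zero_eq_eval_zero] at this
    exact left_eq_add.1 this
  refine ⟨f.natDegree + 1, fun l => f.coeff (p ^ l), fun l hl => ?_, fun R _ _ x => ?_⟩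
  · refine coeff_eq_zero_of_natDegree_lt ?_
    exact (Nat.lt_of_succ_le hl).trans (Nat.lt_pow_self (Fact.out : p.Prime).one_lt)
  · conv_lhs => rw [eq_teichmuller_add_verschiebung x]
    rw [iterate_map_add, map_add, ← Function.iterate_succ_apply, hh, add_zero, hf,
      aeval_eq_sum_pow_of_additive (p := p) (hadd k[X][X] X (C X)) hf0 (Nat.lt_succ_self _)]

/-- On `V^n W` the operator `c F^l V^a` becomes `V^N (F^N(c) F^l x)`. The leading coefficients are
therefore matched by Teichmüller lifts of their `p^N`-th roots. -/
theorem WittNatHom.exists_coeff_aux [CharP k p] [PerfectRing k p] (h : WittNatHom p k (N + 1))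
    {a : ℕ} (ha : a + n = N)
    (hh : ∀ (R : Type u) [CommRing R] [Algebra k R] (x : WittVector p R),
      h.app R (verschiebung^[n + 1] x) = 0) :
    ∃ (M : ℕ) (c : ℕ → WittVector p k), (∀ l, M ≤ l → c l = 0) ∧
      ∀ (R : Type u) [CommRing R] [Algebra k R] (x : WittVector p R),
        (h.sub (WittNatHom.ofCoeff (N + 1) a M c)).app R (verschiebung^[n] x) = 0 := by
  obtain ⟨M, b, hb0, hb⟩ := h.exists_leading_coeff hh
  choose d hd using fun l => (bijective_iterateFrobenius k p N).surjective (b l)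
  have hd' : ∀ l, d l ^ p ^ N = b l := hd
  refine ⟨M, fun l => teichmuller p (d l), fun l hl => ?_, fun R _ _ x => ?_⟩
  · have : d l = 0 := eq_zero_of_pow_eq_zero ((hd' l).trans (hb0 l hl))
    simp only [this, teichmuller_zero]
  · rcases subsingleton_or_nontrivial R with hR | hR
    · exact TruncatedWittVector.ext fun _ => Subsingleton.elim _ _
    have : CharP R p := charP_of_injective_algebraMap (algebraMap k R).injective p
    change h.app R _ - (WittNatHom.ofCoeff (N + 1) a M _).app R _ = 0
    rw [sub_eq_zero, hb, WittNatHom.ofCoeff_apply]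
    have h1 : ∀ l, WittVector.map (algebraMap k R) (teichmuller p (d l)) *
        WittVector.frobenius^[l] (verschiebung^[a] (verschiebung^[n] x))
        = verschiebung^[N] (teichmuller p (algebraMap k R (b l)) * WittVector.frobenius^[l] x) := by
      intro l
      have h2 : WittVector.frobenius^[N] (teichmuller p (algebraMap k R (d l)))
          = teichmuller p (algebraMap k R (b l)) := by
        rw [← hd', map_pow, frobenius_iterate_teichmuller]
      rw [← Function.iterate_add_apply, ha, map_teichmuller, ←
        verschiebung_iterate_frobenius_iterate, mul_comm, iterate_verschiebung_mul_left, h2,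
        mul_comm]
    simp only [h1]
    rw [← verschiebung_iterate_sum]
    refine truncate_verschiebung_iterate_congr ?_
    rw [teichmuller_coeff_zero]
    change _ = WittVector.constantCoeff _
    rw [map_sum]
    refine Finset.sum_congr rfl fun l _ => ?_
    rw [map_mul]
    exact congrArg₂ (· * ·) (teichmuller_coeff_zero p _).symm (iterate_frobenius_coeff x l 0).symm

/-- Every natural homomorphism `W → W_N` that kills `V^n W` is, up to a power of Frobenius, a
noncommutative polynomial in `F` with coefficients in `W(k)`, applied to `V^{N - n}`. -/
theorem WittNatHom.exists_coeff [CharP k p] [PerfectRing k p] {a : ℕ} (h : WittNatHom p k N)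
    (ha : a + n = N)
    (hh : ∀ (R : Type u) [CommRing R] [Algebra k R] (x : WittVector p R),
      h.app R (verschiebung^[n] x) = 0) :
    ∃ (M : ℕ) (c : ℕ → WittVector p k), ∀ M' ≥ M,
      ∀ (L : Type u) [Field L] [Algebra k L] (x : WittVector p L),
        (frob p)^[n] (h.app L x) = truncate N (∑ l ∈ Finset.range M',
          WittVector.map (algebraMap k L) (c l) *
            WittVector.frobenius^[l] (verschiebung^[a] x)) := by
  induction n generalizing a h with
  | zero =>
    refine ⟨0, fun _ => 0, fun M' _ L _ _ x => ?_⟩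
    have := hh L x
    rw [Function.iterate_zero, id] at this ⊢
    rw [this]
    simp
  | succ n ih =>
    obtain ⟨N, rfl⟩ : ∃ N', N = N' + 1 := ⟨a + n, by omega⟩
    obtain ⟨Mg, g, hg0, hg⟩ := h.exists_coeff_aux (n := n) (a := a) (by omega) hh
    obtain ⟨M, c, hc⟩ := ih (a := a + 1) _ (by omega) hg
    -- One more Frobenius turns `F V^{a+1}` into `p V^a`, whence the coefficient `p F(c_l)`.
    -- Applying `F^{n+1}` to the subtracted part `g` shifts its index by `n + 1`, so its
    -- coefficients below `n + 1` are zero.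
    refine ⟨(n + 1) + (M + Mg), fun l => p * WittVector.frobenius (c l) +
      if l < n + 1 then 0 else WittVector.frobenius^[n + 1] (g (l - (n + 1))),
      fun M' hM' L _ _ x => ?_⟩
    have : CharP L p := charP_of_injective_algebraMap (algebraMap k L).injective p
    obtain ⟨M', rfl⟩ : ∃ M₁, M' = (n + 1) + M₁ := ⟨M' - (n + 1), by omega⟩
    have hM : M ≤ n + 1 + M' := by omega
    have hMg : Mg ≤ M' := by omega
    have h1 := hc _ hM L x
    have h2 : h.app L x = (h.sub (WittNatHom.ofCoeff (N + 1) a Mg g)).app L x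
        + (WittNatHom.ofCoeff (N + 1) a Mg g).app L x := (sub_add_cancel _ _).symm
    rw [h2, frob_iterate_add, Function.iterate_succ_apply', h1, WittNatHom.ofCoeff_apply,
      frob_iterate_truncate,      frob_truncate, ← map_add]
    congr 1
    have h4 : ∀ y : WittVector p L, WittVector.frobenius (verschiebung y) = p * y := fun y => by
      rw [frobenius_verschiebung, mul_comm]
    simp only [map_add, add_mul, Finset.sum_add_distrib]
    congr 1
    · rw [map_sum]
      refine Finset.sum_congr rfl fun l _ => ?_
      have h5 : WittVector.frobenius (WittVector.frobenius^[l] (verschiebung^[a + 1] x))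
          = p * WittVector.frobenius^[l] (verschiebung^[a] x) := by
        rw [← Function.iterate_succ_apply' WittVector.frobenius, Function.iterate_succ_apply,
          Function.iterate_succ_apply' verschiebung, h4, ← RingHom.coe_pow, map_mul, map_natCast]
      rw [map_mul, map_mul, map_natCast, map_frobenius_charP, h5]
      ring
    · rw [Finset.sum_range_add, Finset.sum_eq_zero (s := Finset.range (n + 1)), zero_add]
      · rw [← Finset.sum_subset (Finset.range_mono hMg)]
        · rw [← RingHom.coe_pow, map_sum]
          refine Finset.sum_congr rfl fun l _ => ?_
          rw [map_mul, RingHom.coe_pow, if_neg (by omega), Nat.add_sub_cancel_left,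
            map_frobenius_iterate, ← Function.iterate_add_apply]
        · intro l _ hl
          rw [Finset.mem_range, not_lt] at hl
          rw [if_neg (by omega), Nat.add_sub_cancel_left, hg0 l hl, iterate_map_zero, map_zero,
            zero_mul]
      · intro l hl
        rw [if_pos (Finset.mem_range.1 hl), map_zero, zero_mul]

end WittFil

/-! ### Matrices of homomorphisms with a common target, and their kernels. -/

namespace WittFil

open WittVector

variable {p : ℕ} [Fact p.Prime]

section

variable {R : Type u} [CommRing R] {n a N : ℕ}

theorem truncate_verschiebung_out (hN : n + a = N) (x : WittVector p R) :
    truncate N (verschiebung^[a] (truncate n x).out) = truncate N (verschiebung^[a] x) := by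
  subst hN
  exact truncate_verschiebung_congr a n (TruncatedWittVector.truncateFun_out _)

/-- The homomorphism `V^a : W_n → W_N` for `N = n + a`. -/
noncomputable def shiftHom (hN : n + a = N) :
    TruncatedWittVector p n R →+ TruncatedWittVector p N R :=
  AddMonoidHom.mk' (fun x => truncate N (verschiebung^[a] x.out)) fun x y => by
    obtain ⟨x, rfl⟩ := truncate_surjective p n R x
    obtain ⟨y, rfl⟩ := truncate_surjective p n R y
    rw [← map_add (truncate n), truncate_verschiebung_out hN, truncate_verschiebung_out hN,
      truncate_verschiebung_out hN, iterate_map_add, map_add]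

theorem shiftHom_truncate (hN : n + a = N) (x : WittVector p R) :
    shiftHom hN (truncate n x) = truncate N (verschiebung^[a] x) :=
  truncate_verschiebung_out hN x

theorem shiftHom_injective (hN : n + a = N) :
    Function.Injective (shiftHom hN : TruncatedWittVector p n R →+ _) := by
  intro x y h
  obtain ⟨x, rfl⟩ := truncate_surjective p n R x
  obtain ⟨y, rfl⟩ := truncate_surjective p n R y
  rw [shiftHom_truncate, shiftHom_truncate] at h
  subst hN
  exact truncate_verschiebung_injective a n h

theorem shiftHom_mapW {S : Type u} [CommRing S] (hN : n + a = N) (f : R →+* S)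
    (x : TruncatedWittVector p n R) : shiftHom hN (mapW p f x) = mapW p f (shiftHom hN x) := by
  obtain ⟨x, rfl⟩ := truncate_surjective p n R x
  rw [shiftHom_truncate, mapW_truncate, mapW_truncate, shiftHom_truncate, map_verschiebung_iterate]

theorem truncate_verschiebung_self (x : WittVector p R) :
    truncate n (verschiebung^[n] x) = 0 := by
  ext i
  rw [coeff_truncate, TruncatedWittVector.coeff_zero, iterate_verschiebung_coeff_eq_zero _ i.2]

theorem mapW_zero {S : Type u} [CommRing S] (f : R →+* S) :
    mapW p f (0 : TruncatedWittVector p n R) = 0 := by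
  rw [← map_zero (truncate n), mapW_truncate, map_zero, map_zero]

end

variable {k : Type u} [Field k] {s s' : ℕ} {n : Fin s → ℕ} {n' : Fin s' → ℕ} {N : ℕ}

/-- The matrix entries of a homomorphism, with common target `W_N`. -/
noncomputable def WittSumHom.entry (h : WittSumHom p k n n') (i : Fin s) (j : Fin s') {a : ℕ}
    (ha : n' j + a = N) : WittNatHom p k N where
  app R _ _ := (shiftHom ha).comp ((Pi.evalAddMonoidHom _ j).comp ((h.app R).comp
    ((AddMonoidHom.single (fun i => TruncatedWittVector p (n i) R) i).comp
      ((truncate (n i) : WittVector p R →+* _) : WittVector p R →+ _))))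
  naturality R S _ _ _ _ f x := by
    have h1 : (fun i' => mapW p f ((Pi.single i (truncate (n i) x) :
        ∀ i, TruncatedWittVector p (n i) R) i'))
        = Pi.single i (truncate (n i) (WittVector.map (f : R →+* S) x)) := by
      funext i'
      by_cases hi : i' = i
      · subst hi
        rw [Pi.single_eq_same, Pi.single_eq_same]
        exact mapW_truncate (f : R →+* S) x
      · rw [Pi.single_eq_of_ne hi, Pi.single_eq_of_ne hi]
        exact mapW_zero (f : R →+* S)
    have h2 := congrFun (h.naturality R S f (Pi.single i (truncate (n i) x))) j
    rw [h1] at h2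
    exact (congrArg (shiftHom ha) h2).trans (shiftHom_mapW ha (f : R →+* S) _)

theorem WittSumHom.shiftHom_app_eq_sum (h : WittSumHom p k n n') (j : Fin s') {a : ℕ}
    (ha : n' j + a = N) (R : Type u) [CommRing R] [Algebra k R] (x : Fin s → WittVector p R) :
    shiftHom ha (h.app R (fun i => truncate (n i) (x i)) j)
      = ∑ i, (h.entry i j ha).app R (x i) := by
  have h1 : (fun i => truncate (n i) (x i))
      = ∑ i, (Pi.single i (truncate (n i) (x i)) : ∀ i, TruncatedWittVector p (n i) R) :=
    (Finset.univ_sum_single _).symm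
  rw [h1, map_sum, Finset.sum_apply, map_sum]
  rfl

/-- A further `F^a` makes the total Frobenius power `a + n = N`, independent of the source, so that
the entries of one row of the matrix can be added. -/
theorem WittNatHom.exists_coeff_of_frobenius_verschiebung [CharP k p] [PerfectRing k p]
    (h : WittNatHom p k N) {n a : ℕ} (ha : a + n = N)
    (hh : ∀ (R : Type u) [CommRing R] [Algebra k R] (x : WittVector p R),
      h.app R (verschiebung^[n] x) = 0) :
    ∃ (M : ℕ) (c : ℕ → WittVector p k), ∀ M' ≥ M,
      ∀ (L : Type u) [Field L] [Algebra k L] (x : WittVector p L),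
        (frob p)^[N] (h.app L x) = truncate N (∑ l ∈ Finset.range M',
          WittVector.map (algebraMap k L) (c l) *
            WittVector.frobenius^[l] (WittVector.frobenius^[a] (verschiebung^[a] x))) := by
  obtain ⟨M, c, hc⟩ := h.exists_coeff ha hh
  refine ⟨M, fun l => WittVector.frobenius^[a] (c l), fun M' hM' L _ _ x => ?_⟩
  have : CharP L p := charP_of_injective_algebraMap (algebraMap k L).injective p
  have h1 : ∀ w : TruncatedWittVector p N L, (frob p)^[N] w = (frob p)^[a] ((frob p)^[n] w) :=
    fun w => by rw [← Function.iterate_add_apply, ha]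
  rw [h1, hc M' hM', frob_iterate_truncate, ← RingHom.coe_pow, map_sum]
  congr 1
  refine Finset.sum_congr rfl fun l _ => ?_
  rw [map_mul, RingHom.coe_pow, ← map_frobenius_iterate, ← Function.iterate_add_apply, add_comm,
    Function.iterate_add_apply]

theorem WittSumHom.exists_coeff [CharP k p] [PerfectRing k p] (h : WittSumHom p k n n')
    {a : Fin s → ℕ} (ha : ∀ i, a i + n i = N) {a' : Fin s' → ℕ} (ha' : ∀ j, n' j + a' j = N) :
    ∃ (M : ℕ) (c : Fin s' → Fin s → ℕ → WittVector p k),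
      ∀ (L : Type u) [Field L] [Algebra k L] (x : Fin s → WittVector p L) (j : Fin s'),
        (frob p)^[N] (shiftHom (ha' j) (h.app L (fun i => truncate (n i) (x i)) j))
          = truncate N (∑ i, ∑ l ∈ Finset.range M, WittVector.map (algebraMap k L) (c j i l) *
            WittVector.frobenius^[l] (WittVector.frobenius^[a i] (verschiebung^[a i] (x i)))) := by
  have key := fun j i => (h.entry i j (ha' j)).exists_coeff_of_frobenius_verschiebung (ha i)
    (fun R _ _ x => by
      change shiftHom (ha' j) (h.app R (Pi.single i (truncate (n i) (verschiebung^[n i] x))) j) = 0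
      rw [truncate_verschiebung_self, Pi.single_zero, map_zero, Pi.zero_apply, map_zero])
  choose M c hc using key
  refine ⟨∑ j, ∑ i, M j i, c, fun L _ _ x j => ?_⟩
  have : CharP L p := charP_of_injective_algebraMap (algebraMap k L).injective p
  rw [h.shiftHom_app_eq_sum, frob_iterate_eq, map_sum, map_sum]
  refine Finset.sum_congr rfl fun i _ => ?_
  rw [← frob_iterate_eq]
  refine hc j i _ ?_ L (x i)
  exact (Finset.single_le_sum (f := M j) (fun _ _ => Nat.zero_le _) (Finset.mem_univ i)).trans
    (Finset.single_le_sum (f := fun j => ∑ i, M j i) (fun _ _ => Nat.zero_le _)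
      (Finset.mem_univ j))

/-- The preimage of `fil^F_m W_N(K)` in the Witt vectors of `K`, as a submodule over `W(k)`. -/
noncomputable def filFSubmodule {K : Type u} [Field K] [CharP K p] [CharP k p] [PerfectRing k p]
    [Algebra k K] [Module (WittVector p k) (WittVector p K)]
    (hsm : ∀ (c : WittVector p k) (x : WittVector p K),
      c • x = WittVector.map (algebraMap k K) c * x)
    {v : Valuation K ℤᵐ⁰} (hk : ∀ a : k, v (algebraMap k K a) ≤ 1) (N m : ℕ) :
    Submodule (WittVector p k) (WittVector p K) where
  carrier := {x | truncate N x ∈ filF v p N m}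
  zero_mem' := by
    change truncate N 0 ∈ filF v p N m
    rw [map_zero]
    exact zero_mem_filF
  add_mem' := by
    intro x y hx hy
    change truncate N (x + y) ∈ filF v p N m
    rw [map_add]
    exact add_mem_filF hx hy
  smul_mem' := by
    intro c x hx
    change truncate N (c • x) ∈ filF v p N m
    rw [hsm, map_mul]
    exact map_mul_mem_filF hk c hx

section

variable {K : Type u} [Field K] [CharP K p] {v : Valuation K ℤᵐ⁰} {m : ℕ}

theorem frob_mem_filF_iff {n : ℕ} (x : TruncatedWittVector p n K) :
    frob p x ∈ filF v p n m ↔ x ∈ filF v p n m :=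
  ⟨mem_filF_of_frob_mem, frob_mem_filF⟩

theorem frob_iterate_mem_filF_iff {n : ℕ} (e : ℕ) (x : TruncatedWittVector p n K) :
    (frob p)^[e] x ∈ filF v p n m ↔ x ∈ filF v p n m := by
  induction e with
  | zero => rfl
  | succ e ih => rw [Function.iterate_succ_apply', frob_mem_filF_iff, ih]

theorem shiftHom_mem_filF_iff {n a : ℕ} (hN : n + a = N) (x : TruncatedWittVector p n K) :
    shiftHom hN x ∈ filF v p N m ↔ x ∈ filF v p n m := by
  obtain ⟨x, rfl⟩ := truncate_surjective p n K x
  subst hN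
  rw [shiftHom_truncate, truncate_mem_filF_iff]

end

/-- A point over an algebraic closure killed by the leading coefficients of `h` gives an element of
the kernel of `h`. -/
theorem WittSumHom.eq_zero_of_injective [CharP k p] (h : WittSumHom p k n n') (hinj : h.Injective)
    (hn : ∀ i, 1 ≤ n i) {a : Fin s → ℕ} (ha : ∀ i, a i + n i = N + 1)
    {a' : Fin s' → ℕ} (ha' : ∀ j, n' j + a' j = N + 1)
    {M : ℕ} {c : Fin s' → Fin s → ℕ → WittVector p k} {L : Type u} [Field L] [Algebra k L]
    (hc : ∀ (x : Fin s → WittVector p L) (j : Fin s'),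
        (frob p)^[N + 1] (shiftHom (ha' j) (h.app L (fun i => truncate (n i) (x i)) j))
          = truncate (N + 1) (∑ i, ∑ l ∈ Finset.range M, WittVector.map (algebraMap k L) (c j i l) *
            WittVector.frobenius^[l] (WittVector.frobenius^[a i] (verschiebung^[a i] (x i)))))
    (z : Fin s → L) (hz : ∀ j, ∑ i, ∑ l ∈ Finset.range M,
      algebraMap k L ((c j i l).coeff 0) * z i ^ p ^ l = 0) : z = 0 := by
  have : CharP L p := charP_of_injective_algebraMap (algebraMap k L).injective p
  have hp := (Fact.out : p.Prime)
  -- Only the last coordinate survives truncation to length `n i`. The exponent makes `F^{a_i}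
  -- V^{a_i} (x i) = V^N [z_i^{p^N}]`, of the same shape for all `i`.
  set x : Fin s → WittVector p L := fun i =>
    verschiebung^[n i - 1] (teichmuller p (z i ^ p ^ (n i - 1))) with hx
  have h1 : ∀ i l, WittVector.frobenius^[l] (WittVector.frobenius^[a i] (verschiebung^[a i] (x i)))
      = verschiebung^[N] (teichmuller p ((z i ^ p ^ N) ^ p ^ l)) := by
    intro i l
    have h2 : a i + (n i - 1) = N := by have := ha i; have := hn i; omega
    rw [hx, ← Function.iterate_add_apply, ← Function.iterate_add_apply, h2,
      ← verschiebung_iterate_frobenius_iterate, frobenius_iterate_teichmuller, ← pow_mul, ← pow_mul,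
      ← pow_add, ← pow_add, show n i - 1 + (l + a i) = N + l by omega]
  have h3 : ∀ j, h.app L (fun i => truncate (n i) (x i)) j = 0 := by
    intro j
    refine shiftHom_injective (ha' j) ((frob_injective (p := p)).iterate (N + 1) ?_)
    rw [hc, map_zero, frob_iterate_zero]
    -- Moving scalars inside `V^N` costs `F^N`. In length `N + 1` only first coordinates inside
    -- matter, and these add up to the `p^N`-th power of the relation `hz`.
    have h4 : ∀ i l, WittVector.map (algebraMap k L) (c j i l) *
        WittVector.frobenius^[l] (WittVector.frobenius^[a i] (verschiebung^[a i] (x i)))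
        = verschiebung^[N] (WittVector.frobenius^[N] (WittVector.map (algebraMap k L) (c j i l)) *
          teichmuller p ((z i ^ p ^ N) ^ p ^ l)) := fun i l => by
      rw [h1, mul_comm, iterate_verschiebung_mul_left, mul_comm]
    simp only [h4]
    simp only [← verschiebung_iterate_sum]
    rw [← map_zero (truncate (N + 1)), ← iterate_map_zero (verschiebung (p := p) (R := L)) N]
    refine truncate_verschiebung_iterate_congr ?_
    rw [zero_coeff]
    change constantCoeff _ = 0
    have h5 : ∀ i l, constantCoeff (WittVector.frobenius^[N]
        (WittVector.map (algebraMap k L) (c j i l)) * teichmuller p ((z i ^ p ^ N) ^ p ^ l))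
        = (algebraMap k L ((c j i l).coeff 0) * z i ^ p ^ l) ^ p ^ N := by
      intro i l
      rw [map_mul, mul_pow]
      refine congrArg₂ (· * ·) ?_ ?_
      · exact (iterate_frobenius_coeff _ N 0).trans (by rw [map_coeff])
      · rw [← pow_mul, ← pow_mul, mul_comm]
        exact teichmuller_coeff_zero p _
    simp only [map_sum, h5]
    simp only [← sum_pow_char_pow]
    rw [hz j, zero_pow (pow_ne_zero _ hp.ne_zero)]
  have h6 : (fun i => truncate (n i) (x i)) = 0 := by
    apply hinj L
    rw [map_zero]
    exact funext h3
  funext i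
  have h7 := congrArg (TruncatedWittVector.coeff ⟨n i - 1, Nat.sub_lt (hn i) one_pos⟩)
    (congrFun h6 i)
  rw [coeff_truncate, Pi.zero_apply, TruncatedWittVector.coeff_zero] at h7
  simp only [hx, coeff_verschiebung_iterate_self, teichmuller_coeff_zero] at h7
  exact eq_zero_of_pow_eq_zero h7

end WittFil

/-! ### The equivalence of the two memberships. -/

theorem mainTheorem2 (p : ℕ) [Fact p.Prime]
    {K : Type u} [Field K] [CharP K p]
    -- the normalized discrete valuation of `K`, written multiplicatively
    (v : Valuation K ℤᵐ⁰) (hv : Function.Surjective v)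
    -- a perfect field contained in the valuation ring of `K`
    {k : Type u} [Field k] [PerfectField k] [Algebra k K]
    (hk : ∀ a : k, algebraMap k K a ∈ v.integer)
    {s s' : ℕ} (n : Fin s → ℕ) (n' : Fin s' → ℕ) (hn : ∀ i, 1 ≤ n i) (hn' : ∀ j, 1 ≤ n' j)
    (h : WittFil.WittSumHom p k n n') (hinj : h.Injective) (m : ℕ)
    (x : ∀ i, TruncatedWittVector p (n i) K) :
    (∀ i, x i ∈ WittFil.filF v p (n i) m) ↔
      (∀ j, h.app K x j ∈ WittFil.filF v p (n' j) m) := by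
  have : CharP k p := RingHom.charP (algebraMap k K) (algebraMap k K).injective p
  have : PerfectRing k p := PerfectField.toPerfectRing p
  -- Any bound for all the lengths would do; in length `N + 1` the last coordinate has index `N`.
  set N := (∑ i, n i) + ∑ j, n' j with hNdef
  have hN : ∀ i, (N + 1 - n i) + n i = N + 1 := fun i => by
    have := Finset.single_le_sum (f := n) (fun _ _ => Nat.zero_le _) (Finset.mem_univ i)
    omega
  have hN' : ∀ j, n' j + (N + 1 - n' j) = N + 1 := fun j => by
    have := Finset.single_le_sum (f := n') (fun _ _ => Nat.zero_le _) (Finset.mem_univ j)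
    omega
  obtain ⟨M, c, hc⟩ := h.exists_coeff hN hN'
  choose y hy using fun i => WittVector.truncate_surjective p (n i) K (x i)
  let X : Fin s → WittVector p K := fun i =>
    WittVector.frobenius^[N + 1 - n i] (WittVector.verschiebung^[N + 1 - n i] (y i))
  let := Module.compHom (WittVector p K) (WittVector.map (p := p) (algebraMap k K))
  have hsm : ∀ (c : WittVector p k) (x : WittVector p K),
      c • x = WittVector.map (algebraMap k K) c * x := fun _ _ => rfl
  let P := WittFil.filFSubmodule hsm (v := v) hk (N + 1) m
  have hmemP : ∀ w, w ∈ P ↔ WittVector.truncate (N + 1) w ∈ WittFil.filF v p (N + 1) m :=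
    fun _ => Iff.rfl
  let F : AddMonoid.End (WittVector p K) :=
    ((WittVector.frobenius : WittVector p K →+* WittVector p K) : WittVector p K →+ WittVector p K)
  have hFP : ∀ w, F w ∈ P ↔ w ∈ P := fun w => by
    rw [hmemP, hmemP, ← WittFil.frob_mem_filF_iff (WittVector.truncate _ w), WittFil.frob_truncate]
    rfl
  have hFpow : ∀ (l : ℕ) (w : WittVector p K), (F ^ l) w = WittVector.frobenius^[l] w :=
    fun l w => by rw [AddMonoid.End.coe_pow]; rfl
  have hxP : ∀ i, x i ∈ WittFil.filF v p (n i) m ↔ X i ∈ P := fun i => by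
    rw [hmemP, ← WittFil.frob_iterate_truncate, WittFil.frob_iterate_mem_filF_iff,
      ← WittFil.shiftHom_truncate ((add_comm _ _).trans (hN i)), WittFil.shiftHom_mem_filF_iff, hy]
  have hhP : ∀ j, h.app K x j ∈ WittFil.filF v p (n' j) m ↔
      ∑ i, ∑ l ∈ Finset.range M, c j i l • (F ^ l) (X i) ∈ P := fun j => by
    have := hc K y j
    simp only [hy] at this
    simp only [hmemP, hsm, hFpow]
    rw [← this, WittFil.frob_iterate_mem_filF_iff, WittFil.shiftHom_mem_filF_iff]
  simp only [hxP, hhP]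
  constructor
  · intro hX j
    have hXl : ∀ i (l : ℕ), (F ^ l) (X i) ∈ P := by
      intro i l
      induction l with
      | zero => exact hX i
      | succ l ih => rw [pow_succ']; exact (hFP _).2 ih
    exact P.sum_mem fun i _ => P.sum_mem fun l _ => P.smul_mem _ (hXl i l)
  · intro hX
    by_contra hcon
    obtain ⟨z, hz0, hz⟩ := exists_point_of_notMem_saturated (k := k) (N + 1) (F := F)
      (fun c w => by
        rw [hsm, hsm, WittVector.map_frobenius_charP]
        exact map_mul WittVector.frobenius _ _) P hFP
      -- The first `N + 1` coordinates of `p^{N+1} w` vanish, so `P` contains `p^{N+1} W(K)`.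
      (fun w => by
        have : WittVector.truncate (N + 1) ((p : WittVector p k) ^ (N + 1) • w) = 0 := by
          ext i
          rw [hsm, map_pow, map_natCast, mul_comm, WittVector.coeff_truncate,
            WittVector.mul_pow_charP_coeff_zero _ i.2, TruncatedWittVector.coeff_zero]
        rw [hmemP, this]
        exact WittFil.zero_mem_filF) X hcon
    exact hz0 (h.eq_zero_of_injective hinj hn hN hN' (hc (AlgebraicClosure k)) z
      fun j => hz M (c j) (hX j))
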